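/- Let $n=m+k$, $G=\begin{bmatrix}I_m\\0_{k\times m}\end{bmatrix}$, $G^\perp=\begin{bmatrix}0_{k\times m}&I_k\end{bmatrix}$, $q^\star\in\mathbb R^n$, and let $U\ni q^\star$ and $P\ni 0$ be open subsets of $\mathbb R^n$. Let $M(q)$ (symmetric positive definite), $M_a^{-1}(q)$ (symmetric; a symbol, not required to be invertible), $V(q)$, $V_d(q)$ be of class $C^2$ on $U$ and let $J_{11}(q,p)\in\mathbb R^{m\times m}$ be skew-symmetric and of class $C^1$ on $U\times P$. Consider the underactuated mechanical system $$\dot q=\nabla_pH,\qquad \dot p=-\nabla_qH+u_v,\qquad u_v=Gu,\qquad H(q,p)=\tfrac12p^\top M^{-1}(q)p+V(q).$$ Write, with $\partial F/\partial q$ the Jacobian, $$E(q,p)=\tfrac12\Big(\tfrac{\partial}{\partial q}(M^{-1}p)\Big)^{\!\top}M,\qquad Y(q,p)=\tfrac12M^{-1}\Big(\tfrac{\partial}{\partial q}(M_a^{-1}p)\Big)^{\!\top}-\tfrac12\tfrac{\partial}{\partial q}(M^{-1}p)\,M_a^{-1},\qquad Y^i(q)=Y(q,e_i).$$ Denote by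 $m_{ij}$, $m_{aij}$, $Y_{ij}$ the blocks of $M^{-1}$, $M_a^{-1}$, $Y$ along the splitting $n=m+k$, and assume that $M^{-1}+M_a^{-1}$ and $m_{11}+m_{a11}$ are invertible on $U$. Put $$M_d=(M_a^{-1}+M^{-1})^{-1},\quad X=(m_{21}+m_{a21})(m_{11}+m_{a11})^{-1},\quad D=\begin{bmatrix}X&-I_k\end{bmatrix},$$ $$s_1=(m_{22}+m_{a22})-X(m_{21}+m_{a21})^\top,\quad s_2=Xm_{11}-m_{21},\quad s_3=Xm_{21}^\top-m_{22}.$$ Assume that the following matching conditions hold on $U$: $$D\,[Y^i+Y^{i\top}]\,D^\top=0\quad(i=1,\dots,n),\qquad s_1G^\perp\nabla V=-s_2G^\top\nabla V_d-s_3G^\perp\nabla V_d .$$ Let $J=\begin{bmatrix}J_{11}&-J_{21}^\top\\J_{21}&J_{22}\end{bmatrix}$, where $$J_{21}=X(J_{11}-Y_{11})+Y_{21},\qquad J_{22}=-\tfrac12D\begin{bmatrix}Y_{11}-Y_{11}^\top+J_{11}^\top-J_{11}&-Y_{12}-Y_{21}^\top\\Y_{12}^\top+Y_{21}&-Y_{22}+Y_{22}^\top\end{bmatrix}D^\top,$$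 and apply the control law $$u=v-G^\top\Big\{M_dM^{-1}\big[-E^\top M_a^{-1}p+\nabla_{q_{a2}}H_a-MJp\big]-\nabla_qV\Big\},$$ where $H_a(q_{a1},q_{a2},p_a)=\frac12p_a^\top M_a^{-1}(q_{a2})p_a+V_d(q_{a2})-V(q_{a1})$ and its gradient is evaluated at $q_{a1}=q_{a2}=q$, $p_a=p$. Then: 1. For all $(q,p)\in U\times P$ and all $v\in\mathbb R^m$ the closed-loop dynamics are $$\begin{bmatrix}\dot q\\\dot p\end{bmatrix}=\begin{bmatrix}0&M^{-1}M_d\\-M_dM^{-1}&J_2\end{bmatrix}\begin{bmatrix}\nabla_qH_d\\\nabla_pH_d\end{bmatrix}+\begin{bmatrix}0\\G\end{bmatrix}v,\qquad H_d=\tfrac12p^\top M_d^{-1}p+V_d,\qquad y=G^\top\nabla_pH_d,$$ $$J_2=M_d\{J+M^{-1}[E-E^\top]M^{-1}\}M_d+M_dM^{-1}E^\top-EM^{-1}M_d=-J_2^\top .$$ 2. If $M_d(q)>0$ in a neighbourhood of $q^\star$ and $V_d$ is positive definite about $q^\star$ relative to its value there (that is, $V_d(q)>V_d(q^\star)$ for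 all $q\ne q^\star$ near $q^\star$), then $(q^\star,0)$ is a stable equilibrium of the closed loop with $v=0$. 3. If, in addition to the hypotheses of 2, $v=-K_dy$ with $K_d\in\mathbb R^{m\times m}$ symmetric positive definite, and $(q^\star,0)$ is locally detectable from $y$ (every solution on $[0,\infty)$ of the closed loop with $v=0$ that starts near $(q^\star,0)$ and satisfies $y\equiv0$ converges to $(q^\star,0)$), then $(q^\star,0)$ is an asymptotically stable equilibrium of the closed loop with $v=-K_dy$. Here the state space is $U\times P$, and (asymptotic) stability is meant in the sense of Lyapunov and includes existence for all $t\ge0$ of solutions starting near the equilibrium. -/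

import Mathlib

open Matrix Set Filter Topology

noncomputable section

/-! ### Calculus on coordinate space -/

/-- The gradient (column of partial derivatives) of a scalar function on coordinate space. -/
def grad {ι : Type*} [Fintype ι] [DecidableEq ι] (f : (ι → ℝ) → ℝ) (q : ι → ℝ) : ι → ℝ :=
  fun i => fderiv ℝ f q (Pi.single i 1)

/-- The Jacobian `∂F/∂q`: its `(i, j)` entry is `∂F_i/∂q_j`. -/
def jacobian {ι : Type*} [Fintype ι] [DecidableEq ι] (F : (ι → ℝ) → (ι → ℝ)) (q : ι → ℝ) :
    Matrix ι ι ℝ :=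
  Matrix.of fun i j => fderiv ℝ F q (Pi.single j 1) i

/-! ### Trajectories, Lyapunov stability, local detectability -/

/-- `x` solves `ẋ = f x` on the time interval `I` and stays in the domain `O` of the system. -/
def IsTrajectory {X : Type*} [NormedAddCommGroup X] [NormedSpace ℝ X]
    (f : X → X) (O : Set X) (I : Set ℝ) (x : ℝ → X) : Prop :=
  ∀ t ∈ I, x t ∈ O ∧ HasDerivWithinAt x (f (x t)) I t

/-- `xe` is a (Lyapunov) stable equilibrium of `ẋ = f x` on `O`: it is an equilibrium and for
every neighbourhood `N` of `xe` there is a neighbourhood `N'` of `xe` such that from every point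
of `N'` there is a solution for all `t ≥ 0`, and every solution, on any time interval `[0, T)`,
that starts in `N'` stays in `N`. -/
def IsStableEquilibrium {X : Type*} [NormedAddCommGroup X] [NormedSpace ℝ X]
    (f : X → X) (O : Set X) (xe : X) : Prop :=
  f xe = 0 ∧ ∀ N ∈ 𝓝 xe, ∃ N' ∈ 𝓝 xe,
    (∀ x₀ ∈ N', ∃ x : ℝ → X, x 0 = x₀ ∧ IsTrajectory f O (Ici 0) x) ∧
    ∀ T : ℝ, 0 < T → ∀ x : ℝ → X, IsTrajectory f O (Ico 0 T) x → x 0 ∈ N' →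
      ∀ t ∈ Ico 0 T, x t ∈ N

/-- Asymptotic stability: stability together with local attractivity. -/
def IsAsymptoticallyStableEquilibrium {X : Type*} [NormedAddCommGroup X] [NormedSpace ℝ X]
    (f : X → X) (O : Set X) (xe : X) : Prop :=
  IsStableEquilibrium f O xe ∧ ∃ N' ∈ 𝓝 xe, ∀ x : ℝ → X, IsTrajectory f O (Ici 0) x →
    x 0 ∈ N' → Tendsto x atTop (𝓝 xe)

/-- Local detectability of `xe` from the output `y = h x`: every solution of `ẋ = f x` that starts
near `xe` and along which the output vanishes identically converges to `xe`. -/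
def IsLocallyDetectable {X Z : Type*} [NormedAddCommGroup X] [NormedSpace ℝ X] [Zero Z]
    (f : X → X) (h : X → Z) (O : Set X) (xe : X) : Prop :=
  ∃ Ω ∈ 𝓝 xe, ∀ x : ℝ → X, IsTrajectory f O (Ici 0) x → x 0 ∈ Ω →
    (∀ t, 0 ≤ t → h (x t) = 0) → Tendsto x atTop (𝓝 xe)

namespace Mech

/-- Configuration (or momentum) vectors in `ℝⁿ`, `n = m + k`: the first `m` coordinates are
actuated, the remaining `k = n - m` are not. -/
abbrev Vec (m k : ℕ) : Type := Fin m ⊕ Fin k → ℝ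

/-- Real `n × n` matrices, `n = m + k`. -/
abbrev Mat (m k : ℕ) : Type := Matrix (Fin m ⊕ Fin k) (Fin m ⊕ Fin k) ℝ

/-- The input matrix `G = [I_m; 0]`. -/
def G (m k : ℕ) : Matrix (Fin m ⊕ Fin k) (Fin m) ℝ := Matrix.fromRows 1 0

/-- The left annihilator `G^⊥ = [0  I_{n-m}]`. -/
def Gperp (m k : ℕ) : Matrix (Fin k) (Fin m ⊕ Fin k) ℝ := Matrix.fromCols 0 1

variable {m k : ℕ}

/-- `½ pᵀ A(q) p + W(q)`, where `A` is the inverse mass matrix and `W` the potential energy. -/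
def energy (A : Vec m k → Mat m k) (W : Vec m k → ℝ) (q p : Vec m k) : ℝ :=
  1 / 2 * (p ⬝ᵥ (A q *ᵥ p)) + W q

/-- `∇_q H`. -/
def gradQ (H : Vec m k → Vec m k → ℝ) (q p : Vec m k) : Vec m k := grad (fun q' => H q' p) q

/-- `∇_p H`. -/
def gradP (H : Vec m k → Vec m k → ℝ) (q p : Vec m k) : Vec m k := grad (fun p' => H q p') p

/-- The Hamiltonian of the plant, `H = ½ pᵀ M⁻¹(q) p + V(q)`. -/
def plantEnergy (M : Vec m k → Mat m k) (V : Vec m k → ℝ) : Vec m k → Vec m k → ℝ :=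
  energy (fun q => (M q)⁻¹) V

/-- The right-hand side of the plant with virtual input `u_v`:
`q̇ = ∇_p H`, `ṗ = -∇_q H + u_v`. -/
def plantField (M : Vec m k → Mat m k) (V : Vec m k → ℝ) (x : Vec m k × Vec m k)
    (uv : Vec m k) : Vec m k × Vec m k :=
  (gradP (plantEnergy M V) x.1 x.2, -gradQ (plantEnergy M V) x.1 x.2 + uv)

/-- `E(q,p) = ½ (∂/∂q (M⁻¹(q) p))ᵀ M(q)`. -/
def E (M : Vec m k → Mat m k) (q p : Vec m k) : Mat m k :=
  (1 / 2 : ℝ) • ((jacobian (fun q' => (M q')⁻¹ *ᵥ p) q)ᵀ * M q)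

/-- The closed-loop mass matrix `M_d = (M_a⁻¹ + M⁻¹)⁻¹`. The argument `A` is the added inverse mass
`M_a⁻¹`, which is a symbol of its own and need not be an invertible matrix. -/
def Md (M A : Vec m k → Mat m k) (q : Vec m k) : Mat m k := (A q + (M q)⁻¹)⁻¹

/-- The energy of the controller,
`H_a(q_{a1}, q_{a2}, p_a) = ½ p_aᵀ M_a⁻¹(q_{a2}) p_a + V_d(q_{a2}) - V(q_{a1})`. -/
def addedEnergy (A : Vec m k → Mat m k) (V Vd : Vec m k → ℝ) (qa1 qa2 pa : Vec m k) : ℝ :=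
  1 / 2 * (pa ⬝ᵥ (A qa2 *ᵥ pa)) + (Vd qa2 - V qa1)

/-- `∇_{q_{a2}} H_a` evaluated at `q_{a1} = q_{a2} = q`, `p_a = p`. -/
def gradAddedEnergy (A : Vec m k → Mat m k) (V Vd : Vec m k → ℝ) (q p : Vec m k) : Vec m k :=
  grad (fun qa2 => addedEnergy A V Vd q qa2 p) q

/-- `Y(q,p) = ½ M⁻¹ (∂/∂q (M_a⁻¹ p))ᵀ - ½ (∂/∂q (M⁻¹ p)) M_a⁻¹`; the matrix `Yⁱ(q)` is
`Y(q, e_i)`. -/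
def Y (M A : Vec m k → Mat m k) (q p : Vec m k) : Mat m k :=
  (1 / 2 : ℝ) • ((M q)⁻¹ * (jacobian (fun q' => A q' *ᵥ p) q)ᵀ)
    - (1 / 2 : ℝ) • (jacobian (fun q' => (M q')⁻¹ *ᵥ p) q * A q)

/-- `(m₂₁ + m_{a21}) (m₁₁ + m_{a11})⁻¹`, with the blocks of `M⁻¹` and `M_a⁻¹` taken along the
splitting into actuated and unactuated coordinates. -/
def X (M A : Vec m k → Mat m k) (q : Vec m k) : Matrix (Fin k) (Fin m) ℝ :=
  ((M q)⁻¹.toBlocks₂₁ + (A q).toBlocks₂₁) * ((M q)⁻¹.toBlocks₁₁ + (A q).toBlocks₁₁)⁻¹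

/-- `D(q) = [(m₂₁ + m_{a21}) (m₁₁ + m_{a11})⁻¹   -I_{n-m}]`. -/
def D (M A : Vec m k → Mat m k) (q : Vec m k) : Matrix (Fin k) (Fin m ⊕ Fin k) ℝ :=
  Matrix.fromCols (X M A q) (-1)

/-- The Schur complement `s₁ = (m₂₂ + m_{a22}) - (m₂₁ + m_{a21}) (m₁₁ + m_{a11})⁻¹ (m₂₁ + m_{a21})ᵀ`. -/
def s1 (M A : Vec m k → Mat m k) (q : Vec m k) : Matrix (Fin k) (Fin k) ℝ :=
  ((M q)⁻¹.toBlocks₂₂ + (A q).toBlocks₂₂)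
    - X M A q * ((M q)⁻¹.toBlocks₂₁ᵀ + (A q).toBlocks₂₁ᵀ)

/-- `s₂ = (m₂₁ + m_{a21}) (m₁₁ + m_{a11})⁻¹ m₁₁ - m₂₁`. -/
def s2 (M A : Vec m k → Mat m k) (q : Vec m k) : Matrix (Fin k) (Fin m) ℝ :=
  X M A q * (M q)⁻¹.toBlocks₁₁ - (M q)⁻¹.toBlocks₂₁

/-- `s₃ = (m₂₁ + m_{a21}) (m₁₁ + m_{a11})⁻¹ m₂₁ᵀ - m₂₂`. -/
def s3 (M A : Vec m k → Mat m k) (q : Vec m k) : Matrix (Fin k) (Fin k) ℝ :=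
  X M A q * (M q)⁻¹.toBlocks₂₁ᵀ - (M q)⁻¹.toBlocks₂₂

/-- The kinetic energy matching condition at `q`: `D (Yⁱ + Yⁱᵀ) Dᵀ = 0` for all `i`. -/
def KineticMatching (M A : Vec m k → Mat m k) (q : Vec m k) : Prop :=
  ∀ i : Fin m ⊕ Fin k,
    D M A q * (Y M A q (Pi.single i 1) + (Y M A q (Pi.single i 1))ᵀ) * (D M A q)ᵀ = 0

/-- The potential energy matching condition at `q`:
`s₁ G^⊥ ∇V = -s₂ Gᵀ ∇V_d - s₃ G^⊥ ∇V_d`. -/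
def PotentialMatching (M A : Vec m k → Mat m k) (V Vd : Vec m k → ℝ) (q : Vec m k) : Prop :=
  s1 M A q *ᵥ (Gperp m k *ᵥ grad V q)
    = -(s2 M A q *ᵥ ((G m k)ᵀ *ᵥ grad Vd q)) - s3 M A q *ᵥ (Gperp m k *ᵥ grad Vd q)

/-- The block `J₂₁ = (m₂₁ + m_{a21}) (m₁₁ + m_{a11})⁻¹ (J₁₁ - Y₁₁) + Y₂₁`. -/
def J21 (M A : Vec m k → Mat m k) (J11 : Vec m k → Vec m k → Matrix (Fin m) (Fin m) ℝ)
    (q p : Vec m k) : Matrix (Fin k) (Fin m) ℝ :=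
  X M A q * (-(Y M A q p).toBlocks₁₁ + J11 q p) + (Y M A q p).toBlocks₂₁

/-- The block `J₂₂ = -½ D [[Y₁₁ - Y₁₁ᵀ + J₁₁ᵀ - J₁₁, -Y₁₂ - Y₂₁ᵀ], [Y₁₂ᵀ + Y₂₁, -Y₂₂ + Y₂₂ᵀ]] Dᵀ`. -/
def J22 (M A : Vec m k → Mat m k) (J11 : Vec m k → Vec m k → Matrix (Fin m) (Fin m) ℝ)
    (q p : Vec m k) : Matrix (Fin k) (Fin k) ℝ :=
  -((1 / 2 : ℝ) • (D M A q
    * Matrix.fromBlocks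
        ((Y M A q p).toBlocks₁₁ - (Y M A q p).toBlocks₁₁ᵀ + (J11 q p)ᵀ - J11 q p)
        (-(Y M A q p).toBlocks₁₂ - (Y M A q p).toBlocks₂₁ᵀ)
        ((Y M A q p).toBlocks₁₂ᵀ + (Y M A q p).toBlocks₂₁)
        (-(Y M A q p).toBlocks₂₂ + (Y M A q p).toBlocks₂₂ᵀ)
    * (D M A q)ᵀ))

/-- The interconnection matrix `J = [[J₁₁, -J₂₁ᵀ], [J₂₁, J₂₂]]` of the controller, with the free
skew-symmetric block `J₁₁`. -/
def J (M A : Vec m k → Mat m k) (J11 : Vec m k → Vec m k → Matrix (Fin m) (Fin m) ℝ)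
    (q p : Vec m k) : Mat m k :=
  Matrix.fromBlocks (J11 q p) (-(J21 M A J11 q p)ᵀ) (J21 M A J11 q p) (J22 M A J11 q p)

/-- The control law
`u = v - Gᵀ { M_d M⁻¹ [ -Eᵀ M_a⁻¹ p + ∇_{q_a} H_a - M J p ] - ∇V }`. -/
def control (M A : Vec m k → Mat m k) (V Vd : Vec m k → ℝ)
    (J11 : Vec m k → Vec m k → Matrix (Fin m) (Fin m) ℝ)
    (x : Vec m k × Vec m k) (v : Fin m → ℝ) : Fin m → ℝ :=
  v - (G m k)ᵀ *ᵥ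
    ((Md M A x.1 * (M x.1)⁻¹) *ᵥ
        (-(((E M x.1 x.2)ᵀ * A x.1) *ᵥ x.2) + gradAddedEnergy A V Vd x.1 x.2
          - (M x.1 * J M A J11 x.1 x.2) *ᵥ x.2)
      - grad V x.1)

/-- The plant with the control law applied: `u_v = G u`. -/
def closedLoop (M A : Vec m k → Mat m k) (V Vd : Vec m k → ℝ)
    (J11 : Vec m k → Vec m k → Matrix (Fin m) (Fin m) ℝ)
    (x : Vec m k × Vec m k) (v : Fin m → ℝ) : Vec m k × Vec m k :=
  plantField M V x (G m k *ᵥ control M A V Vd J11 x v)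

/-- `H_d = ½ pᵀ M_d⁻¹(q) p + V_d(q)`. -/
def desiredEnergy (M A : Vec m k → Mat m k) (Vd : Vec m k → ℝ) : Vec m k → Vec m k → ℝ :=
  energy (fun q => (Md M A q)⁻¹) Vd

/-- `J₂ = M_d { J + M⁻¹ (E - Eᵀ) M⁻¹ } M_d + M_d M⁻¹ Eᵀ - E M⁻¹ M_d`. -/
def J2 (M A : Vec m k → Mat m k) (J11 : Vec m k → Vec m k → Matrix (Fin m) (Fin m) ℝ)
    (q p : Vec m k) : Mat m k :=
  Md M A q * (J M A J11 q p + (M q)⁻¹ * (E M q p - (E M q p)ᵀ) * (M q)⁻¹) * Md M A q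
    + Md M A q * (M q)⁻¹ * (E M q p)ᵀ - E M q p * (M q)⁻¹ * Md M A q

/-- The right-hand side of the target port-Hamiltonian system,
`q̇ = M⁻¹ M_d ∇_p H_d`, `ṗ = -M_d M⁻¹ ∇_q H_d + J₂ ∇_p H_d + G v`. -/
def targetField (M A : Vec m k → Mat m k) (Vd : Vec m k → ℝ)
    (J11 : Vec m k → Vec m k → Matrix (Fin m) (Fin m) ℝ)
    (x : Vec m k × Vec m k) (v : Fin m → ℝ) : Vec m k × Vec m k :=
  (((M x.1)⁻¹ * Md M A x.1) *ᵥ gradP (desiredEnergy M A Vd) x.1 x.2,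
    -((Md M A x.1 * (M x.1)⁻¹) *ᵥ gradQ (desiredEnergy M A Vd) x.1 x.2)
      + J2 M A J11 x.1 x.2 *ᵥ gradP (desiredEnergy M A Vd) x.1 x.2
      + G m k *ᵥ v)

/-- The output `y = Gᵀ ∇_p H_d`. -/
def output (M A : Vec m k → Mat m k) (Vd : Vec m k → ℝ) (x : Vec m k × Vec m k) : Fin m → ℝ :=
  (G m k)ᵀ *ᵥ gradP (desiredEnergy M A Vd) x.1 x.2

end Mech

end

/-! Matching. Since `∇_p H_d = M_d⁻¹ p`, the `q̇` equations agree at once. In the `ṗ` equation put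
`b = M_d M⁻¹ [bracket of the control law] - ∇V`. The input can only deliver `G Gᵀ b`, whereas the
target needs `b` itself, so everything rests on `b` lying in the range of `G`. Equivalently `M_d⁻¹
b` lies in `M_d⁻¹ (range G)`, which is `ker D` (`exists_eq_mulVec_of_D_mulVec_eq_zero`). Now `M_d⁻¹
b = (Y - J) p + M⁻¹ ∇V_d - M_d⁻¹ ∇V`. The first term is killed by `D` through kinetic matching and
the choice of `J₂₁`, `J₂₂` (`D_mul_Y_sub_J`). The other two contribute `s₂`, `s₃` and `s₁`, and
cancel by potential matching (`D_mulVec_controlBracket`). What is left is a matrix identity built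
into the formula for `J₂` (`closedLoop_eq_targetField`).

Stability. `J₂` is skew and the off-diagonal blocks of the target system are negative transposes of
each other, so `H_d` changes at the rate `yᵀ v` (`fderiv_desiredEnergy_targetField`). As `H_d` has a
strict local minimum at `(q⋆, 0)`, Lyapunov's theorem gives stability for `v = 0`. With `v = -K_d y`
the rate is `-yᵀ K_d y`, which vanishes only where `y = 0`; there the damped and undamped fields
coincide, and LaSalle's principle together with detectability gives attractivity.

Both theorems are proved by replacing the field near the equilibrium with a bounded, globally
Lipschitz one, whose solutions exist for all `t ≥ 0` and depend continuously on the initial point.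
-/

section Flow

/-! ### Solutions of bounded Lipschitz fields -/

variable {X : Type*} [NormedAddCommGroup X] [NormedSpace ℝ X]

theorem IsTrajectory.mono {f : X → X} {O : Set X} {I I' : Set ℝ} {x : ℝ → X}
    (h : IsTrajectory f O I x) (hI : I' ⊆ I) : IsTrajectory f O I' x :=
  fun t ht => ⟨(h t (hI ht)).1, (h t (hI ht)).2.mono hI⟩

theorem IsTrajectory.to_univ {f : X → X} {O : Set X} {I : Set ℝ} {x : ℝ → X}
    (h : IsTrajectory f O I x) : IsTrajectory f univ I x :=
  fun t ht => ⟨mem_univ _, (h t ht).2⟩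

/-- A trajectory that stays in a set on which the fields `f` and `g` agree. -/
theorem IsTrajectory.congr {f g : X → X} {O O' S : Set X} {I : Set ℝ} {x : ℝ → X}
    (h : IsTrajectory f O I x) (hx : ∀ t ∈ I, x t ∈ S) (hfg : EqOn f g S) (hS : S ⊆ O') :
    IsTrajectory g O' I x :=
  fun t ht => ⟨hS (hx t ht), hfg (hx t ht) ▸ (h t ht).2⟩

/-- Trajectories of an autonomous field can be shifted in time. -/
theorem IsTrajectory.comp_const_add {f : X → X} {O : Set X} {x : ℝ → X}
    (h : IsTrajectory f O (Ici 0) x) {s : ℝ} (hs : 0 ≤ s) :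
    IsTrajectory f O (Ici 0) fun t => x (s + t) := by
  intro t (ht : 0 ≤ t)
  refine ⟨(h (s + t) (add_nonneg hs ht)).1, ?_⟩
  have := (h (s + t) (add_nonneg hs ht)).2.scomp t
    ((hasDerivAt_id t).const_add s).hasDerivWithinAt (t' := Ici 0) (s := Ici 0)
    (fun u (hu : 0 ≤ u) => add_nonneg hs hu)
  simpa [Function.comp_def] using this

theorem IsTrajectory.continuousOn {f : X → X} {O : Set X} {I : Set ℝ} {x : ℝ → X}
    (h : IsTrajectory f O I x) : ContinuousOn x I :=
  fun t ht => (h t ht).2.continuousWithinAt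

/-- Trajectories of a Lipschitz field diverge at most exponentially. -/
theorem IsTrajectory.dist_le {F : X → X} {K : NNReal} (hF : LipschitzWith K F) {T : ℝ}
    {x y : ℝ → X} (hx : IsTrajectory F univ (Icc 0 T) x) (hy : IsTrajectory F univ (Icc 0 T) y)
    {t : ℝ} (ht : t ∈ Icc 0 T) : dist (x t) (y t) ≤ dist (x 0) (y 0) * Real.exp (K * t) := by
  have key {z : ℝ → X} (hz : IsTrajectory F univ (Icc 0 T) z) :
      ∀ s ∈ Ico 0 T, HasDerivWithinAt z (F (z s)) (Ici s) s := fun s hs =>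
    ((hz s ⟨hs.1, hs.2.le⟩).2.mono (Icc_subset_Icc_left hs.1)).mono_of_mem_nhdsWithin
      (Icc_mem_nhdsGE hs.2)
  simpa using dist_le_of_trajectories_ODE (v := fun _ => F) (fun _ => hF) hx.continuousOn (key hx)
    hy.continuousOn (key hy) le_rfl t ht

theorem LipschitzWith.exists_isTrajectory_Icc [CompleteSpace X] {F : X → X} {K L : NNReal}
    (hF : LipschitzWith K F) (hL : ∀ x, ‖F x‖ ≤ L) (z : X) (T : NNReal) :
    ∃ x : ℝ → X, x 0 = z ∧ IsTrajectory F univ (Icc 0 T) x := by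
  -- Speed at most `L` during time `T` covers distance at most `L * T`, so this radius imposes no
  -- restriction on `T`.
  have hPL : IsPicardLindelof (fun _ => F) (⟨0, le_rfl, T.2⟩ : Icc (0 : ℝ) T) z (L * T) 0 L K :=
    { lipschitzOnWith := fun _ _ => hF.lipschitzOnWith
      continuousOn := fun _ _ => continuousOn_const
      norm_le := fun _ _ x _ => hL x
      mul_max_le := by simp }
  obtain ⟨x, hx0, hx⟩ := hPL.exists_eq_forall_mem_Icc_hasDerivWithinAt₀
  exact ⟨x, hx0, fun t ht => ⟨mem_univ _, hx t ht⟩⟩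

theorem LipschitzWith.exists_isTrajectory_Ici [CompleteSpace X] {F : X → X} {K L : NNReal}
    (hF : LipschitzWith K F) (hL : ∀ x, ‖F x‖ ≤ L) (z : X) :
    ∃ x : ℝ → X, x 0 = z ∧ IsTrajectory F univ (Ici 0) x := by
  choose x hx0 hx using fun n : ℕ => hF.exists_isTrajectory_Icc hL z (n + 1)
  simp only [NNReal.coe_add, NNReal.coe_natCast, NNReal.coe_one] at hx
  have agree (i j : ℕ) (t : ℝ) (h0 : 0 ≤ t) (hi : t ≤ i + 1) (hj : t ≤ j + 1) :
      x i t = x j t := by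
    have h := IsTrajectory.dist_le hF ((hx i).mono (Icc_subset_Icc_right hi))
      ((hx j).mono (Icc_subset_Icc_right hj)) (right_mem_Icc.2 h0)
    rw [hx0, hx0, dist_self, zero_mul] at h
    exact dist_le_zero.1 h
  -- At time `t` the solution on `[0, ⌈t⌉₊ + 1]` is used. The extra `1` keeps `t` off the right
  -- endpoint, so by `agree` this single solution describes the glued curve on a whole neighbourhood
  -- of `t` in `[0, ∞)`.
  have hceil (t : ℝ) : t ≤ (⌈t⌉₊ : ℝ) + 1 := (Nat.le_ceil t).trans (by linarith)
  refine ⟨fun t => x ⌈t⌉₊ t, hx0 _, fun t (ht : 0 ≤ t) => ⟨mem_univ _, ?_⟩⟩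
  have hlt : t < (⌈t⌉₊ : ℝ) + 1 := (Nat.le_ceil t).trans_lt (by linarith)
  have hnhds : Icc (0 : ℝ) (⌈t⌉₊ + 1) ∈ 𝓝[Ici 0] t := by
    rw [← Ici_inter_Iic]
    exact inter_mem self_mem_nhdsWithin (mem_nhdsWithin_of_mem_nhds (Iic_mem_nhds hlt))
  refine ((hx ⌈t⌉₊ t ⟨ht, hlt.le⟩).2.mono_of_mem_nhdsWithin hnhds).congr_of_eventuallyEq ?_ rfl
  filter_upwards [hnhds] with s hs
  exact agree _ _ s hs.1 (hceil s) hs.2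

end Flow

/-! ### Lyapunov's theorem and LaSalle's invariance principle -/

section Lyapunov

open Metric

variable {X : Type*} [NormedAddCommGroup X] [NormedSpace ℝ X]

/-- A `C¹` field agrees on a closed ball in its domain with a bounded Lipschitz field. -/
theorem ContDiffOn.exists_lipschitzWith_eqOn_closedBall [FiniteDimensional ℝ X] {f : X → X}
    {O : Set X} (hO : IsOpen O) (hf : ContDiffOn ℝ 1 f O) {c : X} {r : ℝ} (hr : 0 < r)
    (hrO : closedBall c r ⊆ O) :
    ∃ (F : X → X) (K L : NNReal), LipschitzWith K F ∧ (∀ x, ‖F x‖ ≤ L) ∧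
      EqOn F f (closedBall c r) := by
  -- The margin between `r` and `R` leaves room for a bump function equal to `1` on the small ball
  -- and supported inside `O`.
  obtain ⟨R, hrR, hRO⟩ : ∃ R, r < R ∧ closedBall c R ⊆ O := by
    obtain ⟨δ, hδ, h⟩ := (isCompact_closedBall c r).exists_cthickening_subset_open hO hrO
    refine ⟨r + δ, by linarith, ?_⟩
    rwa [cthickening_closedBall hδ.le hr.le, add_comm] at h
  let χ : ContDiffBump c := ⟨r, R, hr, hrR⟩
  have hsmooth : ContDiff ℝ 1 fun x => χ x • f x := by
    rw [contDiff_iff_contDiffAt]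
    intro x
    by_cases hx : x ∈ O
    · exact χ.contDiffAt.smul (hf.contDiffAt (hO.mem_nhds hx))
    -- Outside `O` nothing is known about `f`, but the product is locally zero there.
    · have hx' : x ∉ tsupport χ := fun h => hx (hRO (χ.tsupport_eq ▸ h))
      refine (contDiffAt_const (c := (0 : X))).congr_of_eventuallyEq ?_
      filter_upwards [notMem_tsupport_iff_eventuallyEq.1 hx'] with y hy
      simp [hy]
  have hcpt : HasCompactSupport fun x => χ x • f x := χ.hasCompactSupport.smul_right
  obtain ⟨K, hK⟩ := hsmooth.lipschitzWith_of_hasCompactSupport hcpt one_ne_zero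
  obtain ⟨L, hL⟩ := hcpt.exists_bound_of_continuous hsmooth.continuous
  refine ⟨_, K, L.toNNReal, hK, fun x => (hL x).trans (Real.le_coe_toNNReal L), fun x hx => ?_⟩
  simp only [χ.one_of_mem_closedBall hx, one_smul]

theorem IsTrajectory.hasDerivWithinAt_comp {f : X → X} {O : Set X} {I : Set ℝ} {x : ℝ → X}
    (h : IsTrajectory f O I x) {W : X → ℝ} (hW : ∀ z ∈ O, DifferentiableAt ℝ W z) {t : ℝ}
    (ht : t ∈ I) : HasDerivWithinAt (fun s => W (x s)) (fderiv ℝ W (x t) (f (x t))) I t :=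
  (hW _ (h t ht).1).hasFDerivAt.comp_hasDerivWithinAt t (h t ht).2

/-- A Lyapunov function does not increase along trajectories. -/
theorem IsTrajectory.antitoneOn_comp {f : X → X} {O : Set X} {I : Set ℝ} (hI : Convex ℝ I)
    {x : ℝ → X} (h : IsTrajectory f O I x) {W : X → ℝ} (hW : ∀ z ∈ O, DifferentiableAt ℝ W z)
    (hdec : ∀ z ∈ O, fderiv ℝ W z (f z) ≤ 0) : AntitoneOn (fun s => W (x s)) I :=
  antitoneOn_of_hasDerivWithinAt_nonpos hI
    (fun _ ht => (h.hasDerivWithinAt_comp hW ht).continuousWithinAt)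
    (fun _ ht => (h.hasDerivWithinAt_comp hW (interior_subset ht)).mono interior_subset)
    (fun t ht => hdec _ (h t (interior_subset ht)).1)

/-- A strict minimum of a Lyapunov function has a neighbourhood such that trajectories starting
in it do not leave a given ball. -/
theorem exists_mem_nhds_forall_isTrajectory_mem_ball [FiniteDimensional ℝ X] {xe : X}
    {W : X → ℝ} {r : ℝ} (hr : 0 < r) (hW : ∀ z ∈ closedBall xe r, DifferentiableAt ℝ W z)
    (hmin : ∀ z ∈ closedBall xe r, z ≠ xe → W xe < W z) :
    ∃ N' ∈ 𝓝 xe, ∀ (f : X → X) (T : ℝ) (x : ℝ → X),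
      (∀ z ∈ closedBall xe r, fderiv ℝ W z (f z) ≤ 0) → IsTrajectory f univ (Ico 0 T) x →
      x 0 ∈ N' → ∀ t ∈ Ico 0 T, x t ∈ ball xe r := by
  have hxe : xe ∈ closedBall xe r := mem_closedBall_self hr.le
  -- A level above `W xe` that `W` reaches everywhere on the sphere: a trajectory starting below `c`
  -- cannot cross the sphere while `W` does not increase.
  obtain ⟨c, hc, hcs⟩ := (isCompact_sphere xe r).exists_forall_le' (f := W) (a := W xe)
    (fun z hz => (hW z (sphere_subset_closedBall hz)).continuousAt.continuousWithinAt)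
    (fun z hz => hmin z (sphere_subset_closedBall hz) (ne_of_mem_sphere hz hr.ne'))
  refine ⟨ball xe r ∩ {z | W z < c}, inter_mem (ball_mem_nhds xe hr)
    ((hW xe hxe).continuousAt.eventually (gt_mem_nhds hc)), ?_⟩
  intro f T x hdec hx hx0 t ht
  by_contra hout
  replace hx : IsTrajectory f univ (Icc 0 t) x := hx.mono (Icc_subset_Ico_right ht.2)
  have hcont : ContinuousOn (fun u => dist (x u) xe) (Icc 0 t) :=
    continuous_dist.comp_continuousOn (hx.continuousOn.prodMk continuousOn_const)
  -- The first time at distance at least `r`. By the intermediate value theorem the distance is then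
  -- exactly `r`, and up to that time the trajectory lies in the closed ball, where `W` is known to
  -- decrease.
  obtain ⟨s, ⟨hs, hsr⟩, hsleast⟩ :=
    (isCompact_Icc.of_isClosed_subset (hcont.preimage_isClosed_of_isClosed isClosed_Icc
      (isClosed_Ici (a := r))) inter_subset_left).exists_isLeast
      ⟨t, right_mem_Icc.2 ht.1, (not_lt.1 hout : r ≤ dist (x t) xe)⟩
  obtain ⟨s', hs', hs'r⟩ := intermediate_value_Icc hs.1
    (hcont.mono (Icc_subset_Icc_right hs.2)) ⟨(mem_ball.1 hx0.1).le, hsr⟩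
  obtain rfl : s' = s := le_antisymm hs'.2 (hsleast ⟨⟨hs'.1, hs'.2.trans hs.2⟩, hs'r.ge⟩)
  have hball : ∀ u ∈ Icc 0 s', x u ∈ closedBall xe r := by
    intro u hu
    rcases hu.2.eq_or_lt with rfl | hlt
    · exact hs'r.le
    · exact (not_le.1 fun h : r ≤ dist (x u) xe =>
        absurd (hsleast ⟨⟨hu.1, hu.2.trans hs.2⟩, h⟩) (not_le.2 hlt)).le
  have hx' : IsTrajectory f (closedBall xe r) (Icc 0 s') x :=
    (hx.mono (Icc_subset_Icc_right hs.2)).congr hball (fun _ _ => rfl) subset_rfl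
  have h1 := hx'.antitoneOn_comp (convex_Icc 0 s') hW hdec (left_mem_Icc.2 hs.1)
    (right_mem_Icc.2 hs.1) hs.1
  exact absurd ((hcs (x s') hs'r).trans h1) (not_le.2 hx0.2)

theorem exists_closedBall_subset_of_eventually {X : Type*} [NormedAddCommGroup X] {O N : Set X} {xe : X} (hO : O ∈ 𝓝 xe)
    (hN : N ∈ 𝓝 xe) {W : X → ℝ} (hmin : ∀ᶠ z in 𝓝[≠] xe, W xe < W z) :
    ∃ r > 0, closedBall xe r ⊆ O ∧ closedBall xe r ⊆ N ∧
      ∀ z ∈ closedBall xe r, z ≠ xe → W xe < W z := by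
  obtain ⟨r, hr, h⟩ := nhds_basis_closedBall.mem_iff.1
    (inter_mem (inter_mem hO hN) (eventually_nhdsWithin_iff.1 hmin))
  exact ⟨r, hr, fun z hz => (h hz).1.1, fun z hz => (h hz).1.2, fun z hz => (h hz).2⟩

/-- **Lyapunov's theorem**: a strict local minimum of a function that does not increase along a
`C¹` field is a stable equilibrium. -/
theorem isStableEquilibrium_of_lyapunov [FiniteDimensional ℝ X] {f : X → X} {O : Set X} {xe : X}
    (hO : IsOpen O) (hxe : xe ∈ O) (hf : ContDiffOn ℝ 1 f O) (hf0 : f xe = 0) {W : X → ℝ}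
    (hW : ∀ z ∈ O, DifferentiableAt ℝ W z) (hdec : ∀ z ∈ O, fderiv ℝ W z (f z) ≤ 0)
    (hmin : ∀ᶠ z in 𝓝[≠] xe, W xe < W z) : IsStableEquilibrium f O xe := by
  refine ⟨hf0, fun N hN => ?_⟩
  obtain ⟨r, hr, hrO, hrN, hrW⟩ := exists_closedBall_subset_of_eventually (hO.mem_nhds hxe) hN hmin
  -- `N'` is chosen before the field, so it serves both `f` and its cut-off `F`.
  obtain ⟨N', hN', hstay⟩ :=
    exists_mem_nhds_forall_isTrajectory_mem_ball hr (fun z hz => hW z (hrO hz)) hrW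
  obtain ⟨F, K, L, hF, hL, hFf⟩ := hf.exists_lipschitzWith_eqOn_closedBall hO hr hrO
  refine ⟨N', hN', fun z hz => ?_, fun T _ x hx hx0 t ht => hrN (ball_subset_closedBall
    (hstay f T x (fun z hz => hdec z (hrO hz)) hx.to_univ hx0 t ht))⟩
  -- The global solution of `F` never leaves the ball, where `F = f`, hence it is a solution of `f`.
  obtain ⟨x, rfl, hx⟩ := hF.exists_isTrajectory_Ici hL z
  refine ⟨x, rfl, hx.congr (S := closedBall xe r) (fun t ht => ball_subset_closedBall ?_) hFf hrO⟩
  exact hstay F (t + 1) x (fun z hz => hFf hz ▸ hdec z (hrO hz)) (hx.mono Ico_subset_Ici_self) hz t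
    ⟨ht, by linarith⟩

/-- **LaSalle's invariance principle**: a strict local minimum `xe` of a Lyapunov function is an
asymptotically stable equilibrium of the `C¹` field `f` if `xe` is locally detectable from an
output `h` that vanishes where the Lyapunov function is stationary along `f`, detectability being
with respect to a field `g` that agrees with `f` on the zero set of the output. -/
theorem isAsymptoticallyStableEquilibrium_of_isLocallyDetectable [FiniteDimensional ℝ X]
    {Z : Type*} [Zero Z] {f g : X → X} {h : X → Z} {O : Set X} {xe : X}
    (hO : IsOpen O) (hxe : xe ∈ O) (hf : ContDiffOn ℝ 1 f O) (hf0 : f xe = 0) {W : X → ℝ}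
    (hW : ∀ z ∈ O, DifferentiableAt ℝ W z) (hdec : ∀ z ∈ O, fderiv ℝ W z (f z) ≤ 0)
    (hmin : ∀ᶠ z in 𝓝[≠] xe, W xe < W z)
    (hout : ∀ z ∈ O, fderiv ℝ W z (f z) = 0 → h z = 0) (hfg : ∀ z, h z = 0 → f z = g z)
    (hdet : IsLocallyDetectable g h O xe) : IsAsymptoticallyStableEquilibrium f O xe := by
  have hstable := isStableEquilibrium_of_lyapunov hO hxe hf hf0 hW hdec hmin
  refine ⟨hstable, ?_⟩
  obtain ⟨Ω, hΩ, hdet⟩ := hdet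
  obtain ⟨r, hr, hrO, hrΩ, hrW⟩ := exists_closedBall_subset_of_eventually (hO.mem_nhds hxe) hΩ hmin
  obtain ⟨F, K, L, hF, hL, hFf⟩ := hf.exists_lipschitzWith_eqOn_closedBall hO hr hrO
  obtain ⟨N', hN', -, hstay⟩ := hstable.2 (closedBall xe r) (closedBall_mem_nhds xe hr)
  refine ⟨N', hN', fun x hx hx0 => ?_⟩
  have hxr : ∀ t, 0 ≤ t → x t ∈ closedBall xe r := fun t ht =>
    hstay (t + 1) (by linarith) x (hx.mono Ico_subset_Ici_self) hx0 t ⟨ht, by linarith⟩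
  have hanti := hx.antitoneOn_comp (convex_Ici 0) hW hdec
  have hle : ∀ z ∈ closedBall xe r, W xe ≤ W z := fun z hz => by
    rcases eq_or_ne z xe with rfl | hne
    exacts [le_rfl, (hrW z hz hne).le]
  obtain ⟨c, hc⟩ : ∃ c, Tendsto (fun t => W (x t)) atTop (𝓝 c) := by
    have hanti' : Antitone fun t => W (x (max t 0)) := fun s t hst =>
      hanti (le_max_right s 0) (le_max_right t 0) (max_le_max_right 0 hst)
    refine ⟨_, (tendsto_atTop_ciInf hanti' ⟨W xe, ?_⟩).congr' ?_⟩
    · rintro _ ⟨t, rfl⟩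
      exact hle _ (hxr _ (le_max_right t 0))
    · filter_upwards [eventually_ge_atTop 0] with t ht
      simp only [max_eq_left ht]
  -- By compactness it suffices that every cluster point `z` of the trajectory equals `xe`.
  refine (isCompact_closedBall xe r).tendsto_nhds_of_unique_mapClusterPt
    ((eventually_ge_atTop 0).mono hxr) fun z hz hcl => ?_
  have hFx : IsTrajectory F univ (Ici 0) x := hx.congr hxr hFf.symm (subset_univ _)
  choose φ hφ0 hφ using hF.exists_isTrajectory_Ici hL
  have hφcont (s : ℝ) (hs : 0 ≤ s) : Continuous fun w => φ w s := by
    refine LipschitzWith.continuous (K := (Real.exp (K * s)).toNNReal) ?_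
    refine LipschitzWith.of_dist_le_mul fun w w' => ?_
    have := IsTrajectory.dist_le hF ((hφ w).mono Icc_subset_Ici_self)
      ((hφ w').mono Icc_subset_Ici_self) (right_mem_Icc.2 hs)
    rwa [hφ0, hφ0, mul_comm, ← Real.coe_toNNReal _ (Real.exp_pos _).le] at this
  have hφx (t s : ℝ) (ht : 0 ≤ t) (hs : 0 ≤ s) : φ (x t) s = x (t + s) := by
    have := IsTrajectory.dist_le hF ((hφ (x t)).mono Icc_subset_Ici_self)
      ((hFx.comp_const_add ht).mono Icc_subset_Ici_self) (right_mem_Icc.2 hs)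
    rw [hφ0, add_zero, dist_self, zero_mul] at this
    exact dist_le_zero.1 this
  -- Invariance of the limit set: since `φ (x t) s = x (t + s)` and `φ` is continuous in its initial
  -- point, the solution through `z` consists of cluster points of the trajectory. Hence it stays in
  -- the ball, and `W` equals the limit `c` all along it.
  have hclφ (s : ℝ) (hs : 0 ≤ s) : MapClusterPt (φ z s) atTop fun t => φ (x t) s :=
    hcl.continuousAt_comp (hφcont s hs).continuousAt
  have hφr (s : ℝ) (hs : 0 ≤ s) : φ z s ∈ closedBall xe r := by
    refine isClosed_closedBall.mem_of_mapClusterPt (hclφ s hs) ?_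
    filter_upwards [eventually_ge_atTop 0] with t ht
    exact hφx t s ht hs ▸ hxr _ (add_nonneg ht hs)
  have hφW (s : ℝ) (hs : 0 ≤ s) : W (φ z s) = c := by
    have h1 := (hclφ s hs).continuousAt_comp (hW _ (hrO (hφr s hs))).continuousAt
    have h2 : Tendsto (W ∘ fun t => φ (x t) s) atTop (𝓝 c) := by
      refine (hc.comp (tendsto_atTop_add_const_right atTop s tendsto_id)).congr' ?_
      filter_upwards [eventually_ge_atTop 0] with t ht
      simp [hφx t s ht hs]
    exact eq_of_nhds_neBot (ClusterPt.mono h1 h2)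
  have hφf : IsTrajectory f O (Ici 0) (φ z) := (hφ z).congr hφr hFf hrO
  have hφh (s : ℝ) (hs : 0 ≤ s) : h (φ z s) = 0 := by
    refine hout _ (hrO (hφr s hs)) ?_
    have h1 := hφf.hasDerivWithinAt_comp hW hs
    have h2 : HasDerivWithinAt (fun s => W (φ z s)) 0 (Ici 0) s :=
      (hasDerivWithinAt_const s (Ici 0) c).congr hφW (hφW s hs)
    exact (uniqueDiffOn_Ici (0 : ℝ) s hs).eq_deriv _ h1 h2
  -- With the output identically zero, the solution through `z` also solves the field `g` to which
  -- detectability refers.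
  have hφg : IsTrajectory g O (Ici 0) (φ z) := fun s hs =>
    ⟨(hφf s hs).1, hfg _ (hφh s hs) ▸ (hφf s hs).2⟩
  have hlim := hdet (φ z) hφg ((hφ0 z).symm ▸ hrΩ hz) hφh
  -- Detectability sends the solution through `z` to `xe`, so its constant `W`-value is `W xe`;
  -- strictness of the minimum then forces `z = xe`.
  have hcW : c = W xe := by
    refine tendsto_nhds_unique ?_ ((hW xe hxe).continuousAt.tendsto.comp hlim)
    refine tendsto_const_nhds.congr' ?_
    filter_upwards [eventually_ge_atTop 0] with s hs using (hφW s hs).symm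
  by_contra hne
  exact (hrW z hz hne).ne (by rw [← hcW, ← hφW 0 le_rfl, hφ0])

end Lyapunov

/-! ### Gradients and Jacobians of quadratic energies -/

namespace Mech

variable {m k : ℕ}

section Calculus

variable {ι : Type*} [Fintype ι] [DecidableEq ι]

theorem fderiv_apply_eq_grad_dotProduct (f : (ι → ℝ) → ℝ) (q a : ι → ℝ) :
    fderiv ℝ f q a = grad f q ⬝ᵥ a := by
  conv_lhs => rw [pi_eq_sum_univ' a, map_sum]
  simp only [map_smul, smul_eq_mul, dotProduct, grad]
  exact Finset.sum_congr rfl fun i _ => mul_comm _ _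

theorem grad_congr {f g : (ι → ℝ) → ℝ} {q : ι → ℝ} (h : f =ᶠ[𝓝 q] g) : grad f q = grad g q := by
  unfold grad
  rw [h.fderiv_eq]

theorem jacobian_mulVec_apply {B : (ι → ℝ) → Matrix ι ι ℝ} {q : ι → ℝ}
    (hB : ∀ i j, DifferentiableAt ℝ (fun q => B q i j) q) (p : ι → ℝ) (i j : ι) :
    jacobian (fun q => B q *ᵥ p) q i j
      = ∑ b, fderiv ℝ (fun q => B q i b) q (Pi.single j 1) * p b := by
  have h (i : ι) : HasFDerivAt (fun q => (B q *ᵥ p) i)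
      (∑ b, p b • fderiv ℝ (fun q => B q i b) q) q := by
    simp only [mulVec, dotProduct]
    exact HasFDerivAt.fun_sum fun b _ => (hB i b).hasFDerivAt.mul_const (p b)
  rw [jacobian, Matrix.of_apply, (hasFDerivAt_pi.2 h).fderiv]
  simp [mul_comm]

/-- Linearity in `p`, which lets the kinetic matching condition pass from the basis vectors to all
momenta. -/
theorem jacobian_mulVec_eq_sum {B : (ι → ℝ) → Matrix ι ι ℝ} {q : ι → ℝ}
    (hB : ∀ i j, DifferentiableAt ℝ (fun q => B q i j) q) (p : ι → ℝ) :
    jacobian (fun q => B q *ᵥ p) q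
      = ∑ i, p i • jacobian (fun q => B q *ᵥ Pi.single i 1) q := by
  ext i j
  simp only [Matrix.sum_apply, Matrix.smul_apply, jacobian_mulVec_apply hB]
  simp [Pi.single_apply, mul_comm]

theorem jacobian_add_mulVec {B C : (ι → ℝ) → Matrix ι ι ℝ} {q : ι → ℝ}
    (hB : ∀ i j, DifferentiableAt ℝ (fun q => B q i j) q)
    (hC : ∀ i j, DifferentiableAt ℝ (fun q => C q i j) q) (p : ι → ℝ) :
    jacobian (fun q => (B q + C q) *ᵥ p) q
      = jacobian (fun q => B q *ᵥ p) q + jacobian (fun q => C q *ᵥ p) q := by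
  ext i j
  have hBC : ∀ i j, DifferentiableAt ℝ (fun q => (B q + C q) i j) q := fun i j =>
    (hB i j).add (hC i j)
  have h (b : ι) : fderiv ℝ (fun q => (B q + C q) i b) q
      = fderiv ℝ (fun q => B q i b) q + fderiv ℝ (fun q => C q i b) q :=
    fderiv_fun_add (hB i b) (hC i b)
  simp only [Matrix.add_apply (jacobian _ _), jacobian_mulVec_apply hBC, jacobian_mulVec_apply hB,
    jacobian_mulVec_apply hC, h, _root_.add_apply, add_mul, Finset.sum_add_distrib]

theorem grad_half_quadratic {B : Matrix ι ι ℝ} (hB : B.IsSymm) (w : ℝ) (p : ι → ℝ) :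
    grad (fun p => 1 / 2 * (p ⬝ᵥ (B *ᵥ p)) + w) p = B *ᵥ p := by
  ext i
  have h : HasFDerivAt (fun p : ι → ℝ => 1 / 2 * (p ⬝ᵥ (B *ᵥ p)) + w)
      ((1 / 2 : ℝ) • ∑ j, (p j • ∑ b, B j b • ContinuousLinearMap.proj (φ := fun _ : ι => ℝ) (R := ℝ) b
        + (B *ᵥ p) j • ContinuousLinearMap.proj (φ := fun _ : ι => ℝ) (R := ℝ) j)) p := by
    refine (HasFDerivAt.const_mul ?_ _).add_const _
    refine HasFDerivAt.fun_sum fun j _ => ?_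
    refine HasFDerivAt.mul (hasFDerivAt_apply j p) ?_
    simp only [mulVec, dotProduct]
    exact HasFDerivAt.fun_sum fun b _ => (hasFDerivAt_apply b p).const_mul _
  have hsymm : ∀ j, B j i = B i j := fun j => hB.apply i j
  simp only [grad, h.fderiv]
  simp [Finset.sum_add_distrib, Pi.single_apply, hsymm, mulVec, dotProduct]
  simp only [mul_comm (p _)]
  ring

/-- No symmetry of `B` is needed: both sides have `i`-th entry `½ ∑ p_j p_b ∂_i B_jb + ∂_i W`. -/
theorem grad_half_quadratic_add {B : (ι → ℝ) → Matrix ι ι ℝ} {W : (ι → ℝ) → ℝ} {q : ι → ℝ}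
    (hB : ∀ i j, DifferentiableAt ℝ (fun q => B q i j) q) (hW : DifferentiableAt ℝ W q)
    (p : ι → ℝ) : grad (fun q => 1 / 2 * (p ⬝ᵥ (B q *ᵥ p)) + W q) q
      = ((1 / 2 : ℝ) • (jacobian (fun q => B q *ᵥ p) q)ᵀ) *ᵥ p + grad W q := by
  ext i
  have h : HasFDerivAt (fun q => 1 / 2 * (p ⬝ᵥ (B q *ᵥ p)) + W q)
      ((1 / 2 : ℝ) • ∑ j, p j • ∑ b, p b • fderiv ℝ (fun q => B q j b) q + fderiv ℝ W q) q := by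
    refine (HasFDerivAt.const_mul ?_ _).add hW.hasFDerivAt
    refine HasFDerivAt.fun_sum fun j _ => HasFDerivAt.const_mul ?_ _
    simp only [mulVec, dotProduct]
    exact HasFDerivAt.fun_sum fun b _ => (hB j b).hasFDerivAt.mul_const _
  simp only [grad, h.fderiv]
  simp only [grad, Pi.add_apply, mulVec, dotProduct, Matrix.smul_apply, transpose_apply,
    jacobian_mulVec_apply hB, _root_.add_apply, _root_.smul_apply, _root_.sum_apply, smul_eq_mul,
    Finset.mul_sum, Finset.sum_mul]
  congr 1
  refine Finset.sum_congr rfl fun j _ => Finset.sum_congr rfl fun b _ => ?_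
  ring

end Calculus

/-! ### The matching conditions -/

theorem Y_eq_sum {M A : Vec m k → Mat m k} {q : Vec m k}
    (hM : ∀ i j, DifferentiableAt ℝ (fun q => (M q)⁻¹ i j) q)
    (hA : ∀ i j, DifferentiableAt ℝ (fun q => A q i j) q) (p : Vec m k) :
    Y M A q p = ∑ i, p i • Y M A q (Pi.single i 1) := by
  simp only [Y]
  rw [jacobian_mulVec_eq_sum hM p, jacobian_mulVec_eq_sum hA p]
  simp only [transpose_sum, transpose_smul, Finset.mul_sum, Finset.sum_mul, Finset.smul_sum,
    smul_sub, ← Finset.sum_sub_distrib, Matrix.mul_smul, Matrix.smul_mul, smul_comm (1 / 2 : ℝ)]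

theorem KineticMatching.apply {M A : Vec m k → Mat m k} {q : Vec m k} (h : KineticMatching M A q)
    (hM : ∀ i j, DifferentiableAt ℝ (fun q => (M q)⁻¹ i j) q)
    (hA : ∀ i j, DifferentiableAt ℝ (fun q => A q i j) q) (p : Vec m k) :
    D M A q * (Y M A q p + (Y M A q p)ᵀ) * (D M A q)ᵀ = 0 := by
  rw [Y_eq_sum hM hA p, transpose_sum, ← Finset.sum_add_distrib, Matrix.mul_sum, Matrix.sum_mul]
  refine Finset.sum_eq_zero fun i _ => ?_
  rw [transpose_smul, ← smul_add, Matrix.mul_smul, Matrix.smul_mul, h i, smul_zero]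

/-- The middle factor of `J₂₂` is skew, and the congruence `D · Dᵀ` preserves skewness. -/
theorem J_transpose {M A : Vec m k → Mat m k}
    {J11 : Vec m k → Vec m k → Matrix (Fin m) (Fin m) ℝ} {q p : Vec m k}
    (hJ : (J11 q p)ᵀ = -J11 q p) : (J M A J11 q p)ᵀ = -J M A J11 q p := by
  have h22 : (J22 M A J11 q p)ᵀ = -J22 M A J11 q p := by
    simp only [J22, transpose_neg, transpose_smul, transpose_mul, transpose_transpose,
      fromBlocks_transpose, transpose_add, transpose_sub]
    rw [neg_inj, ← smul_neg, ← Matrix.mul_assoc, ← Matrix.neg_mul, ← Matrix.mul_neg,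
      fromBlocks_neg]
    congr! 4 <;> abel
  rw [J, fromBlocks_transpose, fromBlocks_neg, h22, hJ]
  simp

/-- The first block column vanishes by the choice of `J₂₁`. Hence the second one is `-D (Y - J) Dᵀ`.
Its skew part vanishes by the choice of `J₂₂`; its symmetric part involves only `½ D (Y + Yᵀ) Dᵀ`,
as `J` is skew, and that is zero by kinetic matching. -/
theorem D_mul_Y_sub_J {M A : Vec m k → Mat m k}
    {J11 : Vec m k → Vec m k → Matrix (Fin m) (Fin m) ℝ} {q p : Vec m k}
    (hJ : (J11 q p)ᵀ = -J11 q p)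
    (hKE : D M A q * (Y M A q p + (Y M A q p)ᵀ) * (D M A q)ᵀ = 0) :
    D M A q * (Y M A q p - J M A J11 q p) = 0 := by
  rw [D, J, J21, J22, D]
  rw [D] at hKE
  generalize Y M A q p = Z at *
  generalize X M A q = x at *
  generalize J11 q p = j at *
  obtain ⟨a, b, c, d, rfl⟩ : ∃ a b c d, Z = fromBlocks a b c d :=
    ⟨_, _, _, _, (fromBlocks_toBlocks Z).symm⟩
  simp only [fromBlocks_transpose, fromBlocks_add, transpose_fromCols, fromCols_mul_fromBlocks,
    fromCols_mul_fromRows, toBlocks_fromBlocks₁₁, toBlocks_fromBlocks₁₂, toBlocks_fromBlocks₂₁,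
    toBlocks_fromBlocks₂₂, sub_eq_add_neg, fromBlocks_neg, hJ, transpose_add, transpose_neg, transpose_mul,
    transpose_one, Matrix.mul_add, Matrix.add_mul, Matrix.mul_neg, Matrix.neg_mul, Matrix.mul_one,
    Matrix.one_mul, Matrix.mul_assoc] at hKE ⊢
  rw [← fromCols_zero]
  congr 1
  · abel
  · linear_combination (norm := module) (-1 / 2 : ℝ) • hKE

theorem toBlocks₁₂_eq_of_isSymm {B : Mat m k} (hB : B.IsSymm) : B.toBlocks₁₂ = B.toBlocks₂₁ᵀ := by
  ext i j
  exact hB.apply _ _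

theorem D_mul_inv {M A : Vec m k → Mat m k} {q : Vec m k} (hB : (M q)⁻¹.IsSymm) :
    D M A q * (M q)⁻¹ = fromCols (s2 M A q) (s3 M A q) := by
  conv_lhs => rw [← fromBlocks_toBlocks (M q)⁻¹, D, fromCols_mul_fromBlocks,
    toBlocks₁₂_eq_of_isSymm hB]
  simp only [s2, s3, Matrix.neg_mul, Matrix.one_mul, sub_eq_add_neg]

/-- Block elimination: `X` is the multiplier that clears the first block column, leaving minus the
Schur complement. -/
theorem D_mul_add_inv {M A : Vec m k → Mat m k} {q : Vec m k} (hB : (M q)⁻¹.IsSymm)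
    (hA : (A q).IsSymm) (h11 : IsUnit ((M q)⁻¹.toBlocks₁₁ + (A q).toBlocks₁₁).det) :
    D M A q * (A q + (M q)⁻¹) = fromCols 0 (-s1 M A q) := by
  have hX : X M A q * ((M q)⁻¹.toBlocks₁₁ + (A q).toBlocks₁₁)
      = (M q)⁻¹.toBlocks₂₁ + (A q).toBlocks₂₁ := by
    rw [X, Matrix.mul_assoc, nonsing_inv_mul _ h11, Matrix.mul_one]
  conv_lhs => rw [add_comm, ← fromBlocks_toBlocks (M q)⁻¹, ← fromBlocks_toBlocks (A q),
    fromBlocks_add, D, fromCols_mul_fromBlocks, toBlocks₁₂_eq_of_isSymm hB,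
    toBlocks₁₂_eq_of_isSymm hA, hX]
  rw [s1, neg_sub, Matrix.neg_mul, Matrix.one_mul, add_neg_cancel, Matrix.neg_mul, Matrix.one_mul,
    ← sub_eq_add_neg]

/-- The kernel of `D` is the image of `(M_a⁻¹ + M⁻¹) G`. -/
theorem exists_eq_mulVec_of_D_mulVec_eq_zero {M A : Vec m k → Mat m k} {q : Vec m k}
    (h11 : IsUnit ((M q)⁻¹.toBlocks₁₁ + (A q).toBlocks₁₁).det) {w : Vec m k}
    (hw : D M A q *ᵥ w = 0) :
    ∃ u : Fin m → ℝ, w = (A q + (M q)⁻¹) *ᵥ (G m k *ᵥ u) := by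
  obtain ⟨w₁, w₂, rfl⟩ : ∃ w₁ w₂, w = Sum.elim w₁ w₂ :=
    ⟨_, _, (Sum.elim_comp_inl_inr w).symm⟩
  -- The first block row of the desired equation reads `w₁ = (m₁₁ + m_{a11}) u`; the second is then
  -- the relation `w₂ = X w₁` expressed by `D w = 0`.
  obtain ⟨u, hu⟩ : ∃ u, u = ((M q)⁻¹.toBlocks₁₁ + (A q).toBlocks₁₁)⁻¹ *ᵥ w₁ := ⟨_, rfl⟩
  refine ⟨u, ?_⟩
  have h2 : w₂ = X M A q *ᵥ w₁ := by
    rw [D, fromCols_mulVec_sumElim, neg_mulVec, one_mulVec, ← sub_eq_add_neg, sub_eq_zero] at hw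
    exact hw.symm
  conv_rhs => rw [add_comm, ← fromBlocks_toBlocks (M q)⁻¹, ← fromBlocks_toBlocks (A q),
    fromBlocks_add, G, fromRows_mulVec, fromBlocks_mulVec]
  simp only [Sum.elim_comp_inl, Sum.elim_comp_inr, one_mulVec, zero_mulVec, mulVec_zero, add_zero]
  rw [hu, mulVec_mulVec, mulVec_mulVec, mul_nonsing_inv _ h11, one_mulVec, h2, X]

theorem grad_sub_const {ι : Type*} [Fintype ι] [DecidableEq ι] (f : (ι → ℝ) → ℝ) (c : ℝ)
    (q : ι → ℝ) : grad (fun q => f q - c) q = grad f q := by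
  unfold grad
  rw [fderiv_sub_const]

theorem Gtranspose_mul_G : (G m k)ᵀ * G m k = 1 := by
  rw [G, transpose_fromRows, fromCols_mul_fromRows]
  simp

/-- The braces enclose a skew matrix, which congruence by the symmetric `M_d` keeps skew; the two
remaining terms form a matrix minus its transpose. -/
theorem J2_transpose {M A : Vec m k → Mat m k}
    {J11 : Vec m k → Vec m k → Matrix (Fin m) (Fin m) ℝ} {q p : Vec m k}
    (hB : (M q)⁻¹.IsSymm) (hA : (A q).IsSymm) (hJ : (J11 q p)ᵀ = -J11 q p) :
    (J2 M A J11 q p)ᵀ = -J2 M A J11 q p := by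
  have hMd : (Md M A q)ᵀ = Md M A q := by rw [Md, transpose_nonsing_inv, (hA.add hB).eq]
  simp only [J2, transpose_add, transpose_sub, transpose_mul, transpose_transpose, hMd, hB.eq,
    J_transpose hJ]
  noncomm_ring

/-- The bracket in the control law. -/
noncomputable def controlBracket (M A : Vec m k → Mat m k) (V Vd : Vec m k → ℝ)
    (J11 : Vec m k → Vec m k → Matrix (Fin m) (Fin m) ℝ) (q p : Vec m k) : Vec m k :=
  -(((E M q p)ᵀ * A q) *ᵥ p) + gradAddedEnergy A V Vd q p - (M q * J M A J11 q p) *ᵥ p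

theorem E_mul_inv {M : Vec m k → Mat m k} {q : Vec m k} (hM : IsUnit (M q).det) (p : Vec m k) :
    E M q p * (M q)⁻¹ = (1 / 2 : ℝ) • (jacobian (fun q' => (M q')⁻¹ *ᵥ p) q)ᵀ := by
  rw [E, Matrix.smul_mul, Matrix.mul_assoc, mul_nonsing_inv _ hM, Matrix.mul_one]

section ClosedLoop

variable {M A : Vec m k → Mat m k} {V Vd : Vec m k → ℝ}
  {J11 : Vec m k → Vec m k → Matrix (Fin m) (Fin m) ℝ} {q p : Vec m k}

theorem gradAddedEnergy_eq (hA : ∀ i j, DifferentiableAt ℝ (fun q => A q i j) q)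
    (hVd : DifferentiableAt ℝ Vd q) :
    gradAddedEnergy A V Vd q p
      = ((1 / 2 : ℝ) • (jacobian (fun q => A q *ᵥ p) q)ᵀ) *ᵥ p + grad Vd q := by
  unfold gradAddedEnergy addedEnergy
  rw [grad_half_quadratic_add hA (hVd.sub_const _), grad_sub_const]

theorem D_mulVec_controlBracket (hMs : (M q).IsSymm) (hMu : IsUnit (M q).det)
    (hA : (A q).IsSymm) (h11 : IsUnit ((M q)⁻¹.toBlocks₁₁ + (A q).toBlocks₁₁).det)
    (hMd : ∀ i j, DifferentiableAt ℝ (fun q => (M q)⁻¹ i j) q)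
    (hAd : ∀ i j, DifferentiableAt ℝ (fun q => A q i j) q) (hVd : DifferentiableAt ℝ Vd q)
    (hJ : (J11 q p)ᵀ = -J11 q p) (hKE : KineticMatching M A q)
    (hPE : PotentialMatching M A V Vd q) :
    D M A q *ᵥ ((M q)⁻¹ *ᵥ controlBracket M A V Vd J11 q p - (A q + (M q)⁻¹) *ᵥ grad V q) = 0 := by
  have hB : (M q)⁻¹.IsSymm := by rw [IsSymm, transpose_nonsing_inv, hMs.eq]
  have hBE : (M q)⁻¹ * (E M q p)ᵀ = (1 / 2 : ℝ) • jacobian (fun q' => (M q')⁻¹ *ᵥ p) q := by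
    have := congrArg transpose (E_mul_inv hMu p)
    rwa [transpose_mul, hB.eq, transpose_smul, transpose_transpose] at this
  -- `Y` is designed so that `M⁻¹` times the bracket has velocity part `(Y - J) p`, because `M⁻¹ Eᵀ
  -- = ½ ∂(M⁻¹ p)/∂q`.
  have hbr : (M q)⁻¹ *ᵥ controlBracket M A V Vd J11 q p
      = (Y M A q p - J M A J11 q p) *ᵥ p + (M q)⁻¹ *ᵥ grad Vd q := by
    rw [controlBracket, gradAddedEnergy_eq hAd hVd, Y, sub_mulVec, sub_mulVec,
      ← Matrix.smul_mul _ (jacobian _ _) (A q), ← hBE, ← Matrix.mul_smul, mulVec_sub, mulVec_add, mulVec_add, mulVec_neg]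
    simp only [mulVec_mulVec]
    rw [← Matrix.mul_assoc (M q)⁻¹ (M q), nonsing_inv_mul _ hMu, Matrix.one_mul, Matrix.mul_assoc]
    abel
  have hsplit (w : Vec m k) (a : Matrix (Fin k) (Fin m) ℝ) (b : Matrix (Fin k) (Fin k) ℝ) :
      fromCols a b *ᵥ w = a *ᵥ ((G m k)ᵀ *ᵥ w) + b *ᵥ (Gperp m k *ᵥ w) := by
    rw [G, Gperp, transpose_fromRows, fromCols_mulVec, fromCols_mulVec, fromCols_mulVec]
    simp
  rw [hbr, mulVec_sub, mulVec_add, mulVec_mulVec, mulVec_mulVec, mulVec_mulVec,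
    D_mul_Y_sub_J hJ (hKE.apply hMd hAd p), D_mul_inv hB, D_mul_add_inv hB hA h11, hsplit, hsplit,
    neg_mulVec, hPE, zero_mulVec, zero_mulVec]
  abel

theorem gradQ_desiredEnergy (hS : ∀ᶠ q in 𝓝 q, IsUnit (A q + (M q)⁻¹).det)
    (hMd : ∀ i j, DifferentiableAt ℝ (fun q => (M q)⁻¹ i j) q)
    (hAd : ∀ i j, DifferentiableAt ℝ (fun q => A q i j) q) (hVd : DifferentiableAt ℝ Vd q) :
    gradQ (desiredEnergy M A Vd) q p
      = ((1 / 2 : ℝ) • (jacobian (fun q => A q *ᵥ p) q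
          + jacobian (fun q => (M q)⁻¹ *ᵥ p) q)ᵀ) *ᵥ p + grad Vd q := by
  have hd : ∀ i j, DifferentiableAt ℝ (fun q => (A q + (M q)⁻¹) i j) q := fun i j =>
    (hAd i j).add (hMd i j)
  rw [← jacobian_add_mulVec hAd hMd, ← grad_half_quadratic_add hd hVd, gradQ]
  -- Differentiating in `q` needs `M_d⁻¹ = M_a⁻¹ + M⁻¹` on a neighbourhood, not just at the point.
  refine grad_congr ?_
  filter_upwards [hS] with q hq
  rw [desiredEnergy, energy, Md, nonsing_inv_nonsing_inv _ hq]

theorem gradP_desiredEnergy (hMs : (M q).IsSymm) (hA : (A q).IsSymm)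
    (hS : IsUnit (A q + (M q)⁻¹).det) :
    gradP (desiredEnergy M A Vd) q p = (A q + (M q)⁻¹) *ᵥ p := by
  have hB : (M q)⁻¹.IsSymm := by rw [IsSymm, transpose_nonsing_inv, hMs.eq]
  change grad (fun p => 1 / 2 * (p ⬝ᵥ ((A q + (M q)⁻¹)⁻¹⁻¹ *ᵥ p)) + Vd q) p = _
  rw [nonsing_inv_nonsing_inv _ hS, grad_half_quadratic (hA.add hB)]

theorem closedLoop_eq_targetField (hMs : (M q).IsSymm) (hMu : IsUnit (M q).det)
    (hA : (A q).IsSymm) (hS : ∀ᶠ q in 𝓝 q, IsUnit (A q + (M q)⁻¹).det)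
    (h11 : IsUnit ((M q)⁻¹.toBlocks₁₁ + (A q).toBlocks₁₁).det)
    (hMd : ∀ i j, DifferentiableAt ℝ (fun q => (M q)⁻¹ i j) q)
    (hAd : ∀ i j, DifferentiableAt ℝ (fun q => A q i j) q) (hV : DifferentiableAt ℝ V q)
    (hVd : DifferentiableAt ℝ Vd q)
    (hJ : (J11 q p)ᵀ = -J11 q p) (hKE : KineticMatching M A q)
    (hPE : PotentialMatching M A V Vd q) (v : Fin m → ℝ) :
    closedLoop M A V Vd J11 (q, p) v = targetField M A Vd J11 (q, p) v := by
  have hB : (M q)⁻¹.IsSymm := by rw [IsSymm, transpose_nonsing_inv, hMs.eq]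
  have hMdS : Md M A q * (A q + (M q)⁻¹) = 1 := nonsing_inv_mul _ hS.self_of_nhds
  have hP : gradP (plantEnergy M V) q p = (M q)⁻¹ *ᵥ p := by
    unfold gradP plantEnergy energy
    exact grad_half_quadratic hB _ p
  have hQ : gradQ (plantEnergy M V) q p = (E M q p * (M q)⁻¹) *ᵥ p + grad V q := by
    unfold gradQ plantEnergy energy
    rw [grad_half_quadratic_add hMd hV, E_mul_inv hMu]
  have hQd : gradQ (desiredEnergy M A Vd) q p
      = ((1 / 2 : ℝ) • (jacobian (fun q => A q *ᵥ p) q)ᵀ + E M q p * (M q)⁻¹) *ᵥ p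
        + grad Vd q := by
    rw [gradQ_desiredEnergy hS hMd hAd hVd, E_mul_inv hMu, transpose_add, smul_add]
  obtain ⟨u, hu⟩ := exists_eq_mulVec_of_D_mulVec_eq_zero h11
    (D_mulVec_controlBracket hMs hMu hA h11 hMd hAd hVd hJ hKE hPE)
  -- The vector to be cancelled lies in the range of `G`, so the projection `G Gᵀ` in the control
  -- law loses nothing.
  have hu' : (Md M A q * (M q)⁻¹) *ᵥ controlBracket M A V Vd J11 q p - grad V q
      = G m k *ᵥ u := by
    have := congrArg (Md M A q *ᵥ ·) hu
    simpa only [mulVec_sub, mulVec_mulVec, ← Matrix.mul_assoc, hMdS, one_mulVec, Matrix.one_mul]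
      using this
  have hctrl : G m k *ᵥ control M A V Vd J11 (q, p) v
      = G m k *ᵥ v
        - ((Md M A q * (M q)⁻¹) *ᵥ controlBracket M A V Vd J11 q p - grad V q) := by
    have : control M A V Vd J11 (q, p) v = v - (G m k)ᵀ *ᵥ
        ((Md M A q * (M q)⁻¹) *ᵥ controlBracket M A V Vd J11 q p - grad V q) := rfl
    rw [this, hu', mulVec_sub, mulVec_mulVec _ (G m k)ᵀ, Gtranspose_mul_G, one_mulVec]
  -- Equality of the matrices multiplying `p` in the two `ṗ` equations, target on the left and
  -- closed loop on the right; the potential terms match by inspection.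
  have hmat : -(Md M A q * (M q)⁻¹ * ((1 / 2 : ℝ) • (jacobian (fun q => A q *ᵥ p) q)ᵀ
        + E M q p * (M q)⁻¹)) + J2 M A J11 q p * (A q + (M q)⁻¹)
      = -(E M q p * (M q)⁻¹) - Md M A q * (M q)⁻¹ * (-((E M q p)ᵀ * A q)
        + (1 / 2 : ℝ) • (jacobian (fun q => A q *ᵥ p) q)ᵀ - M q * J M A J11 q p) := by
    have h1 : J2 M A J11 q p * (A q + (M q)⁻¹)
        = Md M A q * (J M A J11 q p + (M q)⁻¹ * (E M q p - (E M q p)ᵀ) * (M q)⁻¹)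
          + Md M A q * (M q)⁻¹ * (E M q p)ᵀ * (A q + (M q)⁻¹) - E M q p * (M q)⁻¹ := by
      rw [J2, Matrix.sub_mul, Matrix.add_mul, Matrix.mul_assoc _ (Md M A q), hMdS,
        Matrix.mul_assoc _ (Md M A q), hMdS, Matrix.mul_one, Matrix.mul_one]
    have h2 : Md M A q * (M q)⁻¹ * (M q * J M A J11 q p) = Md M A q * J M A J11 q p := by
      rw [Matrix.mul_assoc, ← Matrix.mul_assoc _ (M q), nonsing_inv_mul _ hMu, Matrix.one_mul]
    rw [h1, Matrix.mul_sub (Md M A q * (M q)⁻¹), h2]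
    noncomm_ring
  have hmat' := congrArg (· *ᵥ p) hmat
  refine Prod.ext ?_ ?_
  · simp only [closedLoop, plantField, targetField]
    rw [hP, gradP_desiredEnergy hMs hA hS.self_of_nhds, mulVec_mulVec, Matrix.mul_assoc, hMdS,
      Matrix.mul_one]
  · simp only [closedLoop, plantField, targetField]
    rw [hctrl, hQ, gradP_desiredEnergy hMs hA hS.self_of_nhds, hQd, controlBracket,
      gradAddedEnergy_eq hAd hVd]
    simp only [mulVec_sub, mulVec_add, mulVec_neg, add_mulVec, sub_mulVec, neg_mulVec,
      mulVec_mulVec, Matrix.mul_add, Matrix.mul_sub, Matrix.mul_neg] at hmat' ⊢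
    linear_combination (norm := module) -hmat'

end ClosedLoop

end Mech

/-! ### Entrywise smoothness of matrix-valued maps -/

/-- A matrix-valued function all of whose entries are of class `C^n` on `s`. -/
def ContDiffOnEntries {X ι κ : Type*} [NormedAddCommGroup X] [NormedSpace ℝ X] (n : WithTop ℕ∞)
    (F : X → Matrix ι κ ℝ) (s : Set X) : Prop :=
  ∀ i j, ContDiffOn ℝ n (fun x => F x i j) s

namespace ContDiffOnEntries

variable {X ι κ l l' : Type*} [NormedAddCommGroup X] [NormedSpace ℝ X] {n : WithTop ℕ∞} {s : Set X}

theorem of_le {F : X → Matrix ι κ ℝ} {n' : WithTop ℕ∞} (hF : ContDiffOnEntries n F s)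
    (h : n' ≤ n) : ContDiffOnEntries n' F s := fun i j => (hF i j).of_le h

theorem add {F H : X → Matrix ι κ ℝ} (hF : ContDiffOnEntries n F s)
    (hH : ContDiffOnEntries n H s) : ContDiffOnEntries n (fun x => F x + H x) s :=
  fun i j => (hF i j).add (hH i j)

theorem sub {F H : X → Matrix ι κ ℝ} (hF : ContDiffOnEntries n F s)
    (hH : ContDiffOnEntries n H s) : ContDiffOnEntries n (fun x => F x - H x) s :=
  fun i j => (hF i j).sub (hH i j)

theorem neg {F : X → Matrix ι κ ℝ} (hF : ContDiffOnEntries n F s) :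
    ContDiffOnEntries n (fun x => -F x) s :=
  fun i j => (hF i j).neg

theorem const_smul {F : X → Matrix ι κ ℝ} (c : ℝ) (hF : ContDiffOnEntries n F s) :
    ContDiffOnEntries n (fun x => c • F x) s :=
  fun i j => (hF i j).const_smul c

theorem const (B : Matrix ι κ ℝ) : ContDiffOnEntries n (fun _ : X => B) s :=
  fun _ _ => contDiffOn_const

theorem transpose {F : X → Matrix ι κ ℝ} (hF : ContDiffOnEntries n F s) :
    ContDiffOnEntries n (fun x => (F x)ᵀ) s :=
  fun i j => hF j i

theorem mul [Fintype κ] {F : X → Matrix ι κ ℝ} {H : X → Matrix κ l ℝ}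
    (hF : ContDiffOnEntries n F s) (hH : ContDiffOnEntries n H s) :
    ContDiffOnEntries n (fun x => F x * H x) s :=
  fun i j => ContDiffOn.sum fun b _ => (hF i b).mul (hH b j)

theorem mulVec [Fintype κ] [Fintype ι] {F : X → Matrix ι κ ℝ} {w : X → κ → ℝ}
    (hF : ContDiffOnEntries n F s) (hw : ContDiffOn ℝ n w s) :
    ContDiffOn ℝ n (fun x => F x *ᵥ w x) s :=
  contDiffOn_pi.2 fun i => ContDiffOn.sum fun b _ => (hF i b).mul (contDiffOn_pi.1 hw b)

theorem det [Fintype ι] [DecidableEq ι] {F : X → Matrix ι ι ℝ} (hF : ContDiffOnEntries n F s) :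
    ContDiffOn ℝ n (fun x => (F x).det) s := by
  simp only [det_apply]
  exact ContDiffOn.sum fun σ _ => (contDiffOn_prod fun i _ => hF (σ i) i).const_smul _

theorem inv [Fintype ι] [DecidableEq ι] {F : X → Matrix ι ι ℝ} (hF : ContDiffOnEntries n F s)
    (hdet : ∀ x ∈ s, IsUnit (F x).det) : ContDiffOnEntries n (fun x => (F x)⁻¹) s := by
  intro i j
  -- Cramer's rule: each entry of the inverse is a quotient of determinants.
  simp only [inv_def, Ring.inverse_eq_inv', Matrix.smul_apply, adjugate_apply, smul_eq_mul]
  refine (hF.det.inv fun x hx => (hdet x hx).ne_zero).mul (ContDiffOnEntries.det fun a b => ?_)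
  simp only [updateRow_apply]
  split_ifs
  exacts [contDiffOn_const, hF a b]

theorem submatrix {F : X → Matrix ι κ ℝ} (hF : ContDiffOnEntries n F s) (a : l → ι) (b : l' → κ) :
    ContDiffOnEntries n (fun x => (F x).submatrix a b) s :=
  fun i j => hF (a i) (b j)

theorem fromBlocks {B₁₁ : X → Matrix ι κ ℝ} {B₁₂ : X → Matrix ι l ℝ} {B₂₁ : X → Matrix l' κ ℝ}
    {B₂₂ : X → Matrix l' l ℝ} (h₁₁ : ContDiffOnEntries n B₁₁ s) (h₁₂ : ContDiffOnEntries n B₁₂ s)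
    (h₂₁ : ContDiffOnEntries n B₂₁ s) (h₂₂ : ContDiffOnEntries n B₂₂ s) :
    ContDiffOnEntries n (fun x => Matrix.fromBlocks (B₁₁ x) (B₁₂ x) (B₂₁ x) (B₂₂ x)) s := by
  rintro (i | i) (j | j)
  exacts [h₁₁ i j, h₁₂ i j, h₂₁ i j, h₂₂ i j]

theorem fromCols {B₁ : X → Matrix ι κ ℝ} {B₂ : X → Matrix ι l ℝ} (h₁ : ContDiffOnEntries n B₁ s)
    (h₂ : ContDiffOnEntries n B₂ s) :
    ContDiffOnEntries n (fun x => Matrix.fromCols (B₁ x) (B₂ x)) s := by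
  rintro i (j | j)
  exacts [h₁ i j, h₂ i j]

theorem comp {Z : Type*} [NormedAddCommGroup Z] [NormedSpace ℝ Z] {t : Set Z}
    {F : X → Matrix ι κ ℝ} {g : Z → X} (hF : ContDiffOnEntries n F s) (hg : ContDiffOn ℝ n g t)
    (h : MapsTo g t s) : ContDiffOnEntries n (fun z => F (g z)) t :=
  fun i j => (hF i j).comp hg h

end ContDiffOnEntries

/-! ### Regularity of the closed loop, power balance, minimum of the energy -/

namespace Mech

variable {m k : ℕ}

theorem contDiffOn_grad {W : Vec m k → ℝ} {U P : Set (Vec m k)} (hU : IsOpen U)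
    (hW : ContDiffOn ℝ 2 W U) :
    ContDiffOn ℝ 1 (fun x : Vec m k × Vec m k => grad W x.1) (U ×ˢ P) := by
  refine contDiffOn_pi.2 fun i => ?_
  exact ((hW.fderiv_of_isOpen hU (by norm_num)).clm_apply contDiffOn_const).comp contDiffOn_fst
    fun x hx => hx.1

theorem contDiffOnEntries_jacobian_mulVec {B : Vec m k → Mat m k} {U P : Set (Vec m k)}
    (hU : IsOpen U) (hB : ContDiffOnEntries 2 B U) :
    ContDiffOnEntries 1
      (fun x : Vec m k × Vec m k => jacobian (fun q => B q *ᵥ x.2) x.1) (U ×ˢ P) := by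
  intro i j
  have h : ContDiffOn ℝ 1 (fun x : Vec m k × Vec m k =>
      ∑ b, fderiv ℝ (fun q => B q i b) x.1 (Pi.single j 1) * x.2 b) (U ×ˢ P) := by
    refine ContDiffOn.sum fun b _ => ContDiffOn.mul ?_ (contDiffOn_pi.1 contDiffOn_snd b)
    exact (((hB i b).fderiv_of_isOpen hU (by norm_num)).clm_apply contDiffOn_const).comp
      contDiffOn_fst fun x hx => hx.1
  refine h.congr fun x hx => jacobian_mulVec_apply (fun i j => ?_) x.2 i j
  exact ((hB i j).differentiableOn two_ne_zero).differentiableAt (hU.mem_nhds hx.1)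

/-- The closed-loop field with a `C¹` feedback is of class `C¹`. -/
theorem contDiffOn_closedLoop {M A : Vec m k → Mat m k} {V Vd : Vec m k → ℝ}
    {J11 : Vec m k → Vec m k → Matrix (Fin m) (Fin m) ℝ} {U P : Set (Vec m k)}
    (hU : IsOpen U) (hM2 : ContDiffOnEntries 2 M U) (hA2 : ContDiffOnEntries 2 A U)
    (hV2 : ContDiffOn ℝ 2 V U) (hVd2 : ContDiffOn ℝ 2 Vd U)
    (hJ1 : ContDiffOnEntries 1 (fun x : Vec m k × Vec m k => J11 x.1 x.2) (U ×ˢ P))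
    (hMs : ∀ q ∈ U, (M q).IsSymm) (hMu : ∀ q ∈ U, IsUnit (M q).det)
    (hS : ∀ q ∈ U, IsUnit (A q + (M q)⁻¹).det)
    (h11 : ∀ q ∈ U, IsUnit ((M q)⁻¹.toBlocks₁₁ + (A q).toBlocks₁₁).det)
    {v : Vec m k × Vec m k → Fin m → ℝ} (hv : ContDiffOn ℝ 1 v (U ×ˢ P)) :
    ContDiffOn ℝ 1 (fun x => closedLoop M A V Vd J11 x (v x)) (U ×ˢ P) := by
  have hfst : ContDiffOn ℝ 2 (Prod.fst : Vec m k × Vec m k → Vec m k) (U ×ˢ P) := contDiffOn_fst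
  have hmaps : MapsTo (Prod.fst : Vec m k × Vec m k → Vec m k) (U ×ˢ P) U := fun x hx => hx.1
  have hp : ContDiffOn ℝ 1 (fun x : Vec m k × Vec m k => x.2) (U ×ˢ P) := contDiffOn_snd
  have hB2 : ContDiffOnEntries 2 (fun q => (M q)⁻¹) U := hM2.inv hMu
  have hM := (hM2.comp hfst hmaps).of_le one_le_two
  have hA := (hA2.comp hfst hmaps).of_le one_le_two
  have hB := (hB2.comp hfst hmaps).of_le one_le_two
  have hMd : ContDiffOnEntries 1 (fun x : Vec m k × Vec m k => Md M A x.1) (U ×ˢ P) :=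
    (hA.add hB).inv fun x hx => hS x.1 hx.1
  have hK := contDiffOnEntries_jacobian_mulVec (P := P) hU hB2
  have hKa := contDiffOnEntries_jacobian_mulVec (P := P) hU hA2
  have hE : ContDiffOnEntries 1 (fun x : Vec m k × Vec m k => E M x.1 x.2) (U ×ˢ P) :=
    (hK.transpose.mul hM).const_smul _
  have hY : ContDiffOnEntries 1 (fun x : Vec m k × Vec m k => Y M A x.1 x.2) (U ×ˢ P) :=
    ((hB.mul hKa.transpose).const_smul _).sub ((hK.mul hA).const_smul _)
  have hX : ContDiffOnEntries 1 (fun x : Vec m k × Vec m k => X M A x.1) (U ×ˢ P) :=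
    ((hB.submatrix Sum.inr Sum.inl).add (hA.submatrix Sum.inr Sum.inl)).mul
      (((hB.submatrix Sum.inl Sum.inl).add (hA.submatrix Sum.inl Sum.inl)).inv
        fun x hx => h11 x.1 hx.1)
  have hD : ContDiffOnEntries 1 (fun x : Vec m k × Vec m k => D M A x.1) (U ×ˢ P) :=
    hX.fromCols (.const _)
  have hY11 := hY.submatrix (Sum.inl : Fin m → Fin m ⊕ Fin k) (Sum.inl : Fin m → Fin m ⊕ Fin k)
  have hY12 := hY.submatrix (Sum.inl : Fin m → Fin m ⊕ Fin k) (Sum.inr : Fin k → Fin m ⊕ Fin k)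
  have hY21 := hY.submatrix (Sum.inr : Fin k → Fin m ⊕ Fin k) (Sum.inl : Fin m → Fin m ⊕ Fin k)
  have hY22 := hY.submatrix (Sum.inr : Fin k → Fin m ⊕ Fin k) (Sum.inr : Fin k → Fin m ⊕ Fin k)
  have hJ21 : ContDiffOnEntries 1 (fun x : Vec m k × Vec m k => J21 M A J11 x.1 x.2) (U ×ˢ P) :=
    (hX.mul (hY11.neg.add hJ1)).add hY21
  have hJ22 : ContDiffOnEntries 1 (fun x : Vec m k × Vec m k => J22 M A J11 x.1 x.2) (U ×ˢ P) :=
    (((hD.mul (.fromBlocks (((hY11.sub hY11.transpose).add hJ1.transpose).sub hJ1)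
      (hY12.neg.sub hY21.transpose) (hY12.transpose.add hY21)
      (hY22.neg.add hY22.transpose))).mul hD.transpose).const_smul _).neg
  have hJ : ContDiffOnEntries 1 (fun x : Vec m k × Vec m k => J M A J11 x.1 x.2) (U ×ˢ P) :=
    .fromBlocks hJ1 hJ21.transpose.neg hJ21 hJ22
  have hgV := contDiffOn_grad (P := P) hU hV2
  have hgVd := contDiffOn_grad (P := P) hU hVd2
  have hdiff {W : Vec m k → ℝ} (hW : ContDiffOn ℝ 2 W U) {q : Vec m k} (hq : q ∈ U) :
      DifferentiableAt ℝ W q := (hW.differentiableOn two_ne_zero).differentiableAt (hU.mem_nhds hq)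
  have hgA : ContDiffOn ℝ 1 (fun x : Vec m k × Vec m k => gradAddedEnergy A V Vd x.1 x.2)
      (U ×ˢ P) :=
    (((hKa.transpose.const_smul (1 / 2)).mulVec hp).add hgVd).congr fun x hx =>
      gradAddedEnergy_eq (fun i j => hdiff (hA2 i j) hx.1) (hdiff hVd2 hx.1)
  have hctrl : ContDiffOn ℝ 1 (fun x => control M A V Vd J11 x (v x)) (U ×ˢ P) :=
    hv.sub ((ContDiffOnEntries.const (G m k)ᵀ).mulVec (((hMd.mul hB).mulVec
      ((((hE.transpose.mul hA).mulVec hp).neg.add hgA).sub ((hM.mul hJ).mulVec hp))).sub hgV))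
  refine ContDiffOn.prodMk ((hB.mulVec hp).congr fun x hx => ?_)
    (ContDiffOn.add (ContDiffOn.neg ?_) ((ContDiffOnEntries.const (G m k)).mulVec hctrl))
  · unfold gradP plantEnergy energy
    exact grad_half_quadratic
      (by rw [IsSymm, transpose_nonsing_inv, (hMs _ hx.1).eq]) _ _
  · refine (((hK.transpose.const_smul (1 / 2)).mulVec hp).add hgV).congr fun x hx => ?_
    unfold gradQ plantEnergy energy
    exact grad_half_quadratic_add (fun i j => hdiff (hB2 i j) hx.1) (hdiff hV2 hx.1) x.2

/-- The derivative of an energy along a vector is given by its partial gradients. -/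
theorem fderiv_uncurry_apply {H : Vec m k → Vec m k → ℝ} {x : Vec m k × Vec m k}
    (hH : DifferentiableAt ℝ (fun x : Vec m k × Vec m k => H x.1 x.2) x) (a : Vec m k × Vec m k) :
    fderiv ℝ (fun x : Vec m k × Vec m k => H x.1 x.2) x a
      = gradQ H x.1 x.2 ⬝ᵥ a.1 + gradP H x.1 x.2 ⬝ᵥ a.2 := by
  have h1 : HasFDerivAt (fun q => H q x.2) (_ ∘L .inl ℝ (Vec m k) (Vec m k)) x.1 :=
    HasFDerivAt.comp (f := fun q => (q, x.2)) x.1 hH.hasFDerivAt (hasFDerivAt_prodMk_left x.1 x.2)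
  have h2 : HasFDerivAt (fun p => H x.1 p) (_ ∘L .inr ℝ (Vec m k) (Vec m k)) x.2 :=
    HasFDerivAt.comp (f := fun p => (x.1, p)) x.2 hH.hasFDerivAt (hasFDerivAt_prodMk_right x.1 x.2)
  rw [gradQ, gradP, ← fderiv_apply_eq_grad_dotProduct, ← fderiv_apply_eq_grad_dotProduct,
    h1.fderiv, h2.fderiv]
  simp [← map_add]

/-- The power balance of the target system: the energy changes at the rate `yᵀ v`. -/
theorem fderiv_desiredEnergy_targetField {M A : Vec m k → Mat m k} {Vd : Vec m k → ℝ}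
    {J11 : Vec m k → Vec m k → Matrix (Fin m) (Fin m) ℝ} {x : Vec m k × Vec m k}
    (hMs : (M x.1).IsSymm) (hA : (A x.1).IsSymm)
    (hJ2 : (J2 M A J11 x.1 x.2)ᵀ = -J2 M A J11 x.1 x.2)
    (hH : DifferentiableAt ℝ (fun x : Vec m k × Vec m k => desiredEnergy M A Vd x.1 x.2) x)
    (v : Fin m → ℝ) :
    fderiv ℝ (fun x : Vec m k × Vec m k => desiredEnergy M A Vd x.1 x.2) x
      (targetField M A Vd J11 x v) = output M A Vd x ⬝ᵥ v := by
  have hB : ((M x.1)⁻¹)ᵀ = (M x.1)⁻¹ := by rw [transpose_nonsing_inv, hMs.eq]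
  have hMd : (Md M A x.1)ᵀ = Md M A x.1 := by
    rw [Md, transpose_nonsing_inv, transpose_add, hA.eq, hB]
  rw [fderiv_uncurry_apply hH, targetField, output]
  generalize gradP (desiredEnergy M A Vd) x.1 x.2 = b
  generalize gradQ (desiredEnergy M A Vd) x.1 x.2 = a
  -- `M_d M⁻¹` and `M⁻¹ M_d` are transposes of each other, so the exchange between the `q` and `p`
  -- parts cancels.
  have h1 : b ⬝ᵥ ((Md M A x.1 * (M x.1)⁻¹) *ᵥ a) = a ⬝ᵥ (((M x.1)⁻¹ * Md M A x.1) *ᵥ b) := by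
    rw [dotProduct_mulVec, ← mulVec_transpose, transpose_mul, hB, hMd, dotProduct_comm]
  have h2 : b ⬝ᵥ (J2 M A J11 x.1 x.2 *ᵥ b) = 0 := by
    have : b ⬝ᵥ (J2 M A J11 x.1 x.2 *ᵥ b) = -(b ⬝ᵥ (J2 M A J11 x.1 x.2 *ᵥ b)) := by
      conv_lhs => rw [dotProduct_mulVec, ← mulVec_transpose, hJ2, neg_mulVec, neg_dotProduct,
        dotProduct_comm]
    linarith
  have h3 : b ⬝ᵥ (G m k *ᵥ v) = ((G m k)ᵀ *ᵥ b) ⬝ᵥ v := by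
    rw [dotProduct_mulVec, mulVec_transpose]
  rw [dotProduct_add, dotProduct_add, dotProduct_neg, h1, h2, h3]
  ring

theorem contDiffOn_desiredEnergy {M A : Vec m k → Mat m k} {Vd : Vec m k → ℝ}
    {U P : Set (Vec m k)} (hM2 : ContDiffOnEntries 2 M U) (hA2 : ContDiffOnEntries 2 A U)
    (hVd2 : ContDiffOn ℝ 2 Vd U) (hMu : ∀ q ∈ U, IsUnit (M q).det)
    (hS : ∀ q ∈ U, IsUnit (A q + (M q)⁻¹).det) :
    ContDiffOn ℝ 2 (fun x : Vec m k × Vec m k => desiredEnergy M A Vd x.1 x.2) (U ×ˢ P) := by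
  have hfst : ContDiffOn ℝ 2 (Prod.fst : Vec m k × Vec m k → Vec m k) (U ×ˢ P) := contDiffOn_fst
  have hmaps : MapsTo (Prod.fst : Vec m k × Vec m k → Vec m k) (U ×ˢ P) U := fun x hx => hx.1
  have hp : ContDiffOn ℝ 2 (fun x : Vec m k × Vec m k => x.2) (U ×ˢ P) := contDiffOn_snd
  have hdet (q : Vec m k) (hq : q ∈ U) : IsUnit (Md M A q).det :=
    isUnit_nonsing_inv_det _ (hS q hq)
  have hB : ContDiffOnEntries 2 (fun q => (Md M A q)⁻¹) U :=
    ((hA2.add (hM2.inv hMu)).inv hS).inv hdet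
  have hBp := contDiffOn_pi.1 ((hB.comp hfst hmaps).mulVec hp)
  exact (contDiffOn_const.mul (ContDiffOn.sum fun i _ => (contDiffOn_pi.1 hp i).mul (hBp i))).add
    (hVd2.comp hfst hmaps)

/-- The desired energy has a strict minimum at `(q⋆, 0)`. -/
theorem eventually_desiredEnergy_lt {M A : Vec m k → Mat m k} {Vd : Vec m k → ℝ} {qs : Vec m k}
    (hMd : ∀ᶠ q in 𝓝 qs, (Md M A q).PosDef) (hVd : ∀ᶠ q in 𝓝[≠] qs, Vd qs < Vd q) :
    ∀ᶠ x : Vec m k × Vec m k in 𝓝[≠] (qs, 0),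
      desiredEnergy M A Vd qs 0 < desiredEnergy M A Vd x.1 x.2 := by
  rw [eventually_nhdsWithin_iff] at hVd ⊢
  filter_upwards [(continuous_fst.tendsto (qs, (0 : Vec m k))).eventually (hMd.and hVd)]
  rintro ⟨q, p⟩ ⟨hq, hVq⟩ hne
  have h0 : desiredEnergy M A Vd qs 0 = Vd qs := by simp [desiredEnergy, energy]
  rw [h0, desiredEnergy, energy]
  have hpos : p ≠ 0 → 0 < p ⬝ᵥ ((Md M A q)⁻¹ *ᵥ p) := fun hp => by
    simpa using hq.inv.dotProduct_mulVec_pos hp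
  by_cases hqs : q = qs
  · have hp : p ≠ 0 := fun hp => hne (by simp [hqs, hp])
    have := hpos hp
    rw [hqs] at this ⊢
    linarith
  · have h1 := hVq hqs
    have h2 : 0 ≤ p ⬝ᵥ ((Md M A q)⁻¹ *ᵥ p) := by
      rcases eq_or_ne p 0 with rfl | hp
      exacts [by simp, (hpos hp).le]
    simp only at h1 h2 ⊢
    linarith

end Mech

/-! ### The main theorem -/

theorem mainTheorem1 (m k : ℕ)
    -- the plant (`M`, `V`), the added inverse mass `A = M_a⁻¹`, the desired potential energy `Vd`,
    -- and the free block `J11` of the interconnection matrix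
    (M A : Mech.Vec m k → Mech.Mat m k) (V Vd : Mech.Vec m k → ℝ)
    (J11 : Mech.Vec m k → Mech.Vec m k → Matrix (Fin m) (Fin m) ℝ)
    -- the neighbourhood `U × P` of `(qs, 0)` on which everything is given
    (qs : Mech.Vec m k) (U P : Set (Mech.Vec m k))
    (hU : IsOpen U) (hqs : qs ∈ U) (hP : IsOpen P) (h0 : (0 : Mech.Vec m k) ∈ P)
    -- regularity
    (hM2 : ∀ i j, ContDiffOn ℝ 2 (fun q => M q i j) U)
    (hA2 : ∀ i j, ContDiffOn ℝ 2 (fun q => A q i j) U)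
    (hV2 : ContDiffOn ℝ 2 V U) (hVd2 : ContDiffOn ℝ 2 Vd U)
    (hJ1 : ∀ i j, ContDiffOn ℝ 1
      (fun x : Mech.Vec m k × Mech.Vec m k => J11 x.1 x.2 i j) (U ×ˢ P))
    -- symmetry, positivity of `M`, and existence of the inverses that occur
    (hM : ∀ q ∈ U, (M q).PosDef)
    (hA : ∀ q ∈ U, (A q).IsSymm)
    (hJ : ∀ q ∈ U, ∀ p ∈ P, (J11 q p)ᵀ = -J11 q p)
    (hMd : ∀ q ∈ U, IsUnit (A q + (M q)⁻¹).det)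
    (h11 : ∀ q ∈ U, IsUnit ((M q)⁻¹.toBlocks₁₁ + (A q).toBlocks₁₁).det)
    -- the matching conditions
    (hKE : ∀ q ∈ U, Mech.KineticMatching M A q)
    (hPE : ∀ q ∈ U, Mech.PotentialMatching M A V Vd q) :
    -- the closed loop is the target port-Hamiltonian system
    (∀ q ∈ U, ∀ p ∈ P,
      (Mech.J2 M A J11 q p)ᵀ = -Mech.J2 M A J11 q p ∧
      ∀ v : Fin m → ℝ,
        Mech.closedLoop M A V Vd J11 (q, p) v = Mech.targetField M A Vd J11 (q, p) v) ∧
    -- stability and, with damping injection, asymptotic stability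
    ((∀ᶠ q in 𝓝 qs, (Mech.Md M A q).PosDef) → (∀ᶠ q in 𝓝[≠] qs, Vd qs < Vd q) →
      IsStableEquilibrium (fun x => Mech.closedLoop M A V Vd J11 x 0) (U ×ˢ P) (qs, 0) ∧
      ∀ Kd : Matrix (Fin m) (Fin m) ℝ, Kd.PosDef →
        IsLocallyDetectable (fun x => Mech.closedLoop M A V Vd J11 x 0)
          (Mech.output M A Vd) (U ×ˢ P) (qs, 0) →
        IsAsymptoticallyStableEquilibrium
          (fun x => Mech.closedLoop M A V Vd J11 x (-(Kd *ᵥ Mech.output M A Vd x)))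
          (U ×ˢ P) (qs, 0)) := by

  have hMs : ∀ q ∈ U, (M q).IsSymm := fun q hq =>
    (conjTranspose_eq_transpose_of_trivial (M q)).symm.trans (hM q hq).isHermitian
  have hMu : ∀ q ∈ U, IsUnit (M q).det := fun q hq => (hM q hq).det_pos.ne'.isUnit
  have hM2' : ContDiffOnEntries 2 M U := hM2
  have hA2' : ContDiffOnEntries 2 A U := hA2
  have hJ1' : ContDiffOnEntries 1
      (fun x : Mech.Vec m k × Mech.Vec m k => J11 x.1 x.2) (U ×ˢ P) := hJ1
  have hdiff {W : Mech.Vec m k → ℝ} (hW : ContDiffOn ℝ 2 W U) {q : Mech.Vec m k} (hq : q ∈ U) :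
      DifferentiableAt ℝ W q := (hW.differentiableOn two_ne_zero).differentiableAt (hU.mem_nhds hq)
  have hSev : ∀ q ∈ U, ∀ᶠ q in 𝓝 q, IsUnit (A q + (M q)⁻¹).det := fun q hq =>
    mem_of_superset (hU.mem_nhds hq) hMd
  have hJ2 : ∀ q ∈ U, ∀ p ∈ P, (Mech.J2 M A J11 q p)ᵀ = -Mech.J2 M A J11 q p :=
    fun q hq p hp => Mech.J2_transpose (by rw [IsSymm, transpose_nonsing_inv, (hMs q hq).eq])
      (hA q hq) (hJ q hq p hp)
  have heq : ∀ x ∈ U ×ˢ P, ∀ v,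
      Mech.closedLoop M A V Vd J11 x v = Mech.targetField M A Vd J11 x v :=
    fun x hx v => Mech.closedLoop_eq_targetField (hMs _ hx.1) (hMu _ hx.1) (hA _ hx.1)
      (hSev _ hx.1) (h11 _ hx.1) (fun i j => hdiff (hM2'.inv hMu i j) hx.1)
      (fun i j => hdiff (hA2 i j) hx.1) (hdiff hV2 hx.1) (hdiff hVd2 hx.1)
      (hJ _ hx.1 _ hx.2) (hKE _ hx.1) (hPE _ hx.1) v
  refine ⟨fun q hq p hp => ⟨hJ2 q hq p hp, heq (q, p) ⟨hq, hp⟩⟩, fun hpd hVmin => ?_⟩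
  have hO : IsOpen (U ×ˢ P) := hU.prod hP
  have hxe : (qs, (0 : Mech.Vec m k)) ∈ U ×ˢ P := ⟨hqs, h0⟩
  have hW : ∀ x ∈ U ×ˢ P, DifferentiableAt ℝ
      (fun x : Mech.Vec m k × Mech.Vec m k => Mech.desiredEnergy M A Vd x.1 x.2) x := fun x hx =>
    ((Mech.contDiffOn_desiredEnergy hM2' hA2' hVd2 hMu hMd).differentiableOn
      two_ne_zero).differentiableAt (hO.mem_nhds hx)
  have hWdot (v : Mech.Vec m k × Mech.Vec m k → Fin m → ℝ) : ∀ x ∈ U ×ˢ P,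
      fderiv ℝ (fun x : Mech.Vec m k × Mech.Vec m k => Mech.desiredEnergy M A Vd x.1 x.2) x
        (Mech.closedLoop M A V Vd J11 x (v x)) = Mech.output M A Vd x ⬝ᵥ v x := fun x hx => by
    rw [heq x hx, Mech.fderiv_desiredEnergy_targetField (hMs _ hx.1) (hA _ hx.1)
      (hJ2 _ hx.1 _ hx.2) (hW x hx)]
  have hout : ∀ x ∈ U ×ˢ P,
      Mech.output M A Vd x = (Mech.G m k)ᵀ *ᵥ ((A x.1 + (M x.1)⁻¹) *ᵥ x.2) := fun x hx => by
    rw [Mech.output, Mech.gradP_desiredEnergy (hMs _ hx.1) (hA _ hx.1) (hMd _ hx.1)]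
  -- Needed for the damped closed loop to be a `C¹` field.
  have hout1 : ContDiffOn ℝ 1 (Mech.output M A Vd) (U ×ˢ P) := by
    refine ((ContDiffOnEntries.const (Mech.G m k)ᵀ).mulVec
      (ContDiffOnEntries.mulVec ?_ contDiffOn_snd)).congr hout
    exact ((hA2'.add (hM2'.inv hMu)).comp contDiffOn_fst fun x hx => hx.1).of_le one_le_two
  have hout0 : Mech.output M A Vd (qs, 0) = 0 := by simp [hout _ hxe]
  -- `q⋆` minimizes `V_d`, so at `p = 0` every term of the target field vanishes: this yields the
  -- equilibrium.
  have hgrad0 : grad Vd qs = 0 := by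
    have hmin : IsLocalMin Vd qs := by
      filter_upwards [eventually_nhdsWithin_iff.1 hVmin] with q hq
      rcases eq_or_ne q qs with rfl | hne
      exacts [le_rfl, (hq hne).le]
    ext i
    simp [grad, hmin.fderiv_eq_zero]
  have hf0 : Mech.closedLoop M A V Vd J11 (qs, 0) 0 = 0 := by
    rw [heq _ hxe, Mech.targetField]
    simp only
    rw [Mech.gradP_desiredEnergy (hMs _ hqs) (hA _ hqs) (hMd _ hqs),
      Mech.gradQ_desiredEnergy (hSev _ hqs) (fun i j => hdiff (hM2'.inv hMu i j) hqs)
        (fun i j => hdiff (hA2 i j) hqs) (hdiff hVd2 hqs), hgrad0]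
    simp
  have hmin := Mech.eventually_desiredEnergy_lt hpd hVmin
  have hC1 {v : Mech.Vec m k × Mech.Vec m k → Fin m → ℝ} (hv : ContDiffOn ℝ 1 v (U ×ˢ P)) :=
    Mech.contDiffOn_closedLoop hU hM2' hA2' hV2 hVd2 hJ1' hMs hMu hMd h11 hv
  refine ⟨isStableEquilibrium_of_lyapunov hO hxe (hC1 contDiffOn_const) hf0 hW
    (fun x hx => ?_) hmin, fun Kd hKd hdet => ?_⟩
  · rw [hWdot (fun _ => 0) x hx, dotProduct_zero]
  · have hpow : ∀ x ∈ U ×ˢ P,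
        fderiv ℝ (fun x : Mech.Vec m k × Mech.Vec m k => Mech.desiredEnergy M A Vd x.1 x.2) x
          (Mech.closedLoop M A V Vd J11 x (-(Kd *ᵥ Mech.output M A Vd x)))
        = -(Mech.output M A Vd x ⬝ᵥ (Kd *ᵥ Mech.output M A Vd x)) := fun x hx => by
      rw [hWdot (fun x => -(Kd *ᵥ Mech.output M A Vd x)) x hx, dotProduct_neg]
    have hKpos : ∀ y : Fin m → ℝ, y ≠ 0 → 0 < y ⬝ᵥ (Kd *ᵥ y) := fun y hy => by
      simpa using hKd.dotProduct_mulVec_pos hy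
    -- Here `f` is the damped field and `g` the undamped one, for which detectability is assumed.
    refine isAsymptoticallyStableEquilibrium_of_isLocallyDetectable hO hxe
      (hC1 ((ContDiffOnEntries.const Kd).mulVec hout1).neg) ?_ hW (fun x hx => ?_) hmin
      (fun x hx hx0 => ?_) (fun x hx => ?_) hdet
    · simp only [hout0, mulVec_zero, neg_zero, hf0]
    · rw [hpow x hx]
      rcases eq_or_ne (Mech.output M A Vd x) 0 with hy | hy
      · simp [hy]
      · exact (neg_neg_of_pos (hKpos _ hy)).le
    · by_contra hy
      exact (hKpos _ hy).ne' (by rw [← neg_eq_zero, ← hpow x hx, hx0])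
    · simp only [hx, mulVec_zero, neg_zero]
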